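/- For a continuous $2\pi$-periodic function $f:\mathbb{R}\to\mathbb{R}$ put $\|f\|=\sup_{x}|f(x)|$. For $n\ge 1$ let $E_{n-1}(f)=\inf_{\tau}\|f-\tau\|$, where $\tau$ runs over the real trigonometric polynomials of degree at most $n-1$. For $r\ge 1$ and $\delta>0$ let $$\omega_r(f,\delta)=\sup_{0<h\le\delta}\ \sup_{x\in\mathbb{R}}\Big|\sum_{i=0}^{r}(-1)^i\binom{r}{i}f(x+ih)\Big|,\qquad \gamma_r^*=\binom{r}{\lfloor r/2\rfloor}^{-1}.$$ Theorem. For every real $\alpha>1$ there is a constant $c_\alpha$, depending only on $\alpha$, such that $$E_{n-1}(f)\le c_\alpha\,\gamma_r^*\,\omega_r\Big(f,\frac{\alpha\pi}{n}\Big)$$ for all integers $n\ge 1$ and $r\ge 1$ and all continuous $2\pi$-periodic functions $f:\mathbb{R}\to\mathbb{R}$. Moreover, $c_\alpha$ can be chosen so that $$c_\alpha\le\frac{4}{\pi}\,\frac{\alpha}{\alpha-1}\left(\frac{4}{\pi^2}\ln\frac{2\sqrt{\alpha}}{\sqrt{\alpha}-1}+2\right).$$ -/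

import Mathlib

namespace JacksonStechkin

noncomputable section

/-- The uniform norm of a function on the real line. It is only applied to continuous
`2π`-periodic functions, which are bounded, so the supremum is a genuine one. -/
def supNorm (f : ℝ → ℝ) : ℝ := ⨆ x : ℝ, |f x|

/-- The set of real trigonometric polynomials of degree at most `m`. -/
def trigPoly (m : ℕ) : Set (ℝ → ℝ) :=
  {τ | ∃ a b : ℕ → ℝ, ∀ x : ℝ,
    τ x = ∑ k ∈ Finset.range (m + 1), (a k * Real.cos (k * x) + b k * Real.sin (k * x))}

/-- The value of best uniform approximation of `f` by trigonometric polynomials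
of degree at most `m`. -/
def bestApprox (m : ℕ) (f : ℝ → ℝ) : ℝ :=
  sInf ((fun τ : ℝ → ℝ => supNorm (fun x => f x - τ x)) '' trigPoly m)

/-- The forward difference of order `r` of `f` at `x` with step `h`. -/
def diff (r : ℕ) (h : ℝ) (f : ℝ → ℝ) (x : ℝ) : ℝ :=
  ∑ i ∈ Finset.range (r + 1), (-1 : ℝ) ^ i * (r.choose i : ℝ) * f (x + i * h)

/-- The `r`-th modulus of smoothness of `f` with step `δ`: the supremum of the uniform norms
of the `r`-th differences with steps `0 < h ≤ δ`. -/
def modulus (r : ℕ) (f : ℝ → ℝ) (δ : ℝ) : ℝ :=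
  sSup ((fun h : ℝ => supNorm (diff r h f)) '' Set.Ioc 0 δ)

/-- The reciprocal of the central binomial coefficient `r` over `⌊r / 2⌋`. -/
def gammaStar (r : ℕ) : ℝ := 1 / (r.choose (r / 2) : ℝ)

end

end JacksonStechkin

namespace JacksonStechkin

open MeasureTheory Complex FourierTransform

/-! The inequality comes from inverting an averaged difference operator on high frequencies. For r =
2k take the central difference with step hs, average it over s in (0,1) with weight 2(1 − s), and
divide by ± the central binomial coefficient. The result is the operator 1 − U, where U has symbol
`smoothSymbol k h m / (h² m²)`: a bounded operator composed with two integrations. The average of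
the differences of f is at most γ*_{2k} ω_{2k}(f, h), so it suffices to recover the high-frequency
part of f from it.

On the spectrum |m| ≥ N the inverse is the Neumann series Σ U^j. The symbol in the numerator has
multiplier norm at most π² (`multiplierBound_smoothSymbol`), and 2j integrations have norm at most
(4/π) N^(−2j) (`multiplierBound_inv_pow`). The factor 4/π enters each power only once, so the
inverse has norm at most (4/π) / (1 − (π/(hN))²). With h = απ/n and N = n/√α this equals (4/π) α/(α
− 1).

The approximant is the de la Vallée Poussin mean V, equal to the identity up to N and cut off at n.
Then 1 − V has spectrum in |m| ≥ N, commutes with everything above, and has norm at most (4/π²)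
log(2√α/(√α − 1)) + 2 (`multiplierBound_trapezoid`).

Two L¹ estimates underlie this, both from the expansion of |sin| in squares of sines with positive
coefficients (`hasSum_abs_sin`): one for the Poisson kernel modulated by a cosine, one for the
kernel of V. All operators act on finite exponential sums; f itself is reached by uniform
approximation. Odd orders reduce to the next even order, since γ*_{2k+1} = 2γ*_{2k+2} and ω_{r+1} ≤
2ω_r. -/

/-! ### Exponential sums and Fourier multipliers. -/

/-- The exponential sum with frequencies in `S` and coefficients `c`. -/
noncomputable def expPoly (S : Finset ℤ) (c : ℤ → ℂ) (x : ℝ) : ℂ :=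
  ∑ k ∈ S, c k * cexp ((k * x : ℝ) * I)

/-- The Fourier multiplier `l` has norm at most `B` in the uniform norm on exponential sums with
spectrum in `s`. -/
def MultiplierBound (s : Set ℤ) (l : ℤ → ℂ) (B : ℝ) : Prop :=
  ∀ S : Finset ℤ, (S : Set ℤ) ⊆ s → ∀ (c : ℤ → ℂ) (D : ℝ), (∀ x, ‖expPoly S c x‖ ≤ D) →
    ∀ x, ‖expPoly S (fun k => l k * c k) x‖ ≤ B * D

theorem expPoly_congr {S : Finset ℤ} {c d : ℤ → ℂ} (h : ∀ k ∈ S, c k = d k) (x : ℝ) :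
    expPoly S c x = expPoly S d x :=
  Finset.sum_congr rfl fun k hk => by rw [h k hk]

theorem expPoly_add (S : Finset ℤ) (c d : ℤ → ℂ) (x : ℝ) :
    expPoly S (fun k => c k + d k) x = expPoly S c x + expPoly S d x := by
  simp only [expPoly, ← Finset.sum_add_distrib, add_mul]

theorem expPoly_sub (S : Finset ℤ) (c d : ℤ → ℂ) (x : ℝ) :
    expPoly S (fun k => c k - d k) x = expPoly S c x - expPoly S d x := by
  simp only [expPoly, ← Finset.sum_sub_distrib, sub_mul]

theorem expPoly_const_mul (S : Finset ℤ) (a : ℂ) (c : ℤ → ℂ) (x : ℝ) :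
    expPoly S (fun k => a * c k) x = a * expPoly S c x := by
  simp only [expPoly, Finset.mul_sum, mul_assoc]

theorem expPoly_sum {ι : Type*} (T : Finset ι) (S : Finset ℤ) (c : ι → ℤ → ℂ) (x : ℝ) :
    expPoly S (fun k => ∑ i ∈ T, c i k) x = ∑ i ∈ T, expPoly S (c i) x := by
  simp only [expPoly, Finset.sum_mul]
  exact Finset.sum_comm

theorem expPoly_shift (S : Finset ℤ) (c : ℤ → ℂ) (x t : ℝ) :
    expPoly S (fun k => cexp ((k * t : ℝ) * I) * c k) x = expPoly S c (x + t) := by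
  refine Finset.sum_congr rfl fun k _ => ?_
  rw [mul_right_comm, mul_comm, ← Complex.exp_add]
  congr 2
  push_cast
  ring

theorem norm_expPoly_le (S : Finset ℤ) (c : ℤ → ℂ) (x : ℝ) :
    ‖expPoly S c x‖ ≤ ∑ k ∈ S, ‖c k‖ := by
  refine (norm_sum_le _ _).trans (Finset.sum_le_sum fun k _ => ?_)
  rw [norm_mul, norm_exp_ofReal_mul_I, mul_one]

theorem expPoly_filter_ne_zero (S : Finset ℤ) (p : ℤ → Prop) [DecidablePred p] (c : ℤ → ℂ)
    (h : ∀ k ∈ S, ¬ p k → c k = 0) (x : ℝ) : expPoly (S.filter p) c x = expPoly S c x := by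
  refine Finset.sum_subset (Finset.filter_subset _ _) fun k hk hk' => ?_
  rw [h k hk fun hp => hk' (Finset.mem_filter.2 ⟨hk, hp⟩), zero_mul]

namespace MultiplierBound

variable {s : Set ℤ} {l l' : ℤ → ℂ} {B B' : ℝ}

theorem congr (h : MultiplierBound s l B) (hl : ∀ k ∈ s, l k = l' k) : MultiplierBound s l' B := by
  intro S hS c D hc x
  rw [expPoly_congr (d := fun k => l k * c k) fun k hk => by rw [hl k (hS hk)]]
  exact h S hS c D hc x

theorem mono (h : MultiplierBound s l B) (hB : B ≤ B') : MultiplierBound s l B' := by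
  intro S hS c D hc x
  exact (h S hS c D hc x).trans
    (mul_le_mul_of_nonneg_right hB ((norm_nonneg _).trans (hc 0)))

theorem subset {s' : Set ℤ} (h : MultiplierBound s l B) (hs : s' ⊆ s) : MultiplierBound s' l B :=
  fun S hS => h S (hS.trans hs)

theorem mul (h : MultiplierBound s l B) (h' : MultiplierBound s l' B') :
    MultiplierBound s (fun k => l k * l' k) (B * B') := by
  intro S hS c D hc x
  have := h S hS _ _ (h' S hS c D hc) x
  simpa only [mul_assoc] using this

theorem one : MultiplierBound s (fun _ => 1) 1 := by
  intro S hS c D hc x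
  simpa only [one_mul] using hc x

theorem pow (h : MultiplierBound s l B) (m : ℕ) :
    MultiplierBound s (fun k => l k ^ m) (B ^ m) := by
  induction m with
  | zero => simpa using one
  | succ m ih => simpa only [pow_succ] using ih.mul h

theorem sub (h : MultiplierBound s l B) (h' : MultiplierBound s l' B') :
    MultiplierBound s (fun k => l k - l' k) (B + B') := by
  intro S hS c D hc x
  simp only [sub_mul, expPoly_sub, add_mul]
  exact (norm_sub_le _ _).trans (add_le_add (h S hS c D hc x) (h' S hS c D hc x))

theorem const_mul (h : MultiplierBound s l B) (a : ℂ) :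
    MultiplierBound s (fun k => a * l k) (‖a‖ * B) := by
  intro S hS c D hc x
  simp only [mul_assoc, expPoly_const_mul, norm_mul]
  exact mul_le_mul_of_nonneg_left (h S hS c D hc x) (norm_nonneg _)

theorem sum {ι : Type*} (T : Finset ι) {l : ι → ℤ → ℂ} {B : ι → ℝ}
    (h : ∀ i ∈ T, MultiplierBound s (l i) (B i)) :
    MultiplierBound s (fun k => ∑ i ∈ T, l i k) (∑ i ∈ T, B i) := by
  intro S hS c D hc x
  simp only [Finset.sum_mul, expPoly_sum]
  exact norm_sum_le_of_le _ fun i hi => h i hi S hS c D hc x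

theorem exp (t : ℝ) : MultiplierBound s (fun k => cexp ((k * t : ℝ) * I)) 1 := by
  intro S hS c D hc x
  rw [expPoly_shift, one_mul]
  exact hc _

/-- A superposition of multipliers. -/
theorem integral {T : Type*} [MeasurableSpace T] (μ : Measure T) {l : T → ℤ → ℂ} {B : T → ℝ}
    (h : ∀ᵐ t ∂μ, MultiplierBound s (l t) (B t)) (hl : ∀ k ∈ s, Integrable (fun t => l t k) μ)
    (hB : Integrable B μ) :
    MultiplierBound s (fun k => ∫ t, l t k ∂μ) (∫ t, B t ∂μ) := by
  intro S hS c D hc x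
  have e : expPoly S (fun k => (∫ t, l t k ∂μ) * c k) x
      = ∫ t, expPoly S (fun k => l t k * c k) x ∂μ := by
    unfold expPoly
    rw [integral_finsetSum]
    · refine Finset.sum_congr rfl fun k _ => ?_
      rw [integral_mul_const, integral_mul_const]
    · intro k hk
      exact ((hl k (hS hk)).mul_const _).mul_const _
  rw [e, ← integral_mul_const]
  refine norm_integral_le_of_norm_le (hB.mul_const D) ?_
  filter_upwards [h] with t ht
  exact ht S hS c D hc x

/-- The multiplier of a convolution with an integrable kernel. -/
theorem kernel (μ : Measure ℝ) {K : ℝ → ℝ} (hK : Integrable K μ) :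
    MultiplierBound s (fun k => ∫ t, (K t : ℂ) * cexp ((k * t : ℝ) * I) ∂μ) (∫ t, |K t| ∂μ) := by
  refine integral μ (Filter.Eventually.of_forall fun t => ?_) (fun k _ => ?_) hK.abs
  · simpa using (exp t).const_mul (K t : ℂ)
  · refine (hK.ofReal (𝕜 := ℂ)).mul_bdd (c := 1) (by fun_prop) (Filter.Eventually.of_forall fun t => ?_)
    rw [norm_exp_ofReal_mul_I]

end MultiplierBound

/-! ### The expansion of |sin| in squares of sines. -/

theorem integral_exp_mul_sin (n : ℤ) :
    ∫ x in (0 : ℝ)..Real.pi, cexp ((-2 * n * I) * x) * (Real.sin x : ℂ)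
      = 2 / (1 - 4 * (n : ℂ) ^ 2) := by
  set a : ℂ := -2 * n * I with ha
  have ha2 : a ^ 2 + 1 = 1 - 4 * (n : ℂ) ^ 2 := by
    rw [ha, mul_pow, mul_pow, I_sq]; ring
  have h0 : (1 - 4 * (n : ℂ) ^ 2) ≠ 0 := by
    have : (1 - 4 * n ^ 2 : ℤ) ≠ 0 := by omega
    exact_mod_cast this
  have hd : ∀ x ∈ Set.uIcc (0 : ℝ) Real.pi, HasDerivAt
      (fun x : ℝ => cexp (a * x) * (a * Complex.sin x - Complex.cos x) / (a ^ 2 + 1))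
      (cexp (a * x) * (Real.sin x : ℂ)) x := by
    intro x _
    have h1 : HasDerivAt (fun z : ℂ => cexp (a * z) * (a * Complex.sin z - Complex.cos z)
        / (a ^ 2 + 1))
        ((cexp (a * x) * (a * 1) * (a * Complex.sin x - Complex.cos x)
          + cexp (a * x) * (a * Complex.cos x - -Complex.sin x)) / (a ^ 2 + 1)) (x : ℂ) :=
      (((((hasDerivAt_id (x : ℂ)).const_mul a).cexp).mul
        (((Complex.hasDerivAt_sin _).const_mul a).sub (Complex.hasDerivAt_cos _))).div_const _)
    convert! h1.comp_ofReal using 1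
    rw [ha2]
    field_simp
    rw [← ha2, Complex.ofReal_sin]
    ring
  rw [intervalIntegral.integral_eq_sub_of_hasDerivAt hd
    (by apply Continuous.intervalIntegrable; fun_prop)]
  have he : cexp (a * Real.pi) = 1 := by
    rw [Complex.exp_eq_one_iff]
    exact ⟨-n, by rw [ha]; push_cast; ring⟩
  rw [he, ha2, Complex.sin_pi, Complex.cos_pi]
  simp
  field_simp
  norm_num

/-- The function `|sin|` on the circle of length `π`. -/
noncomputable def absSinCircle : C(AddCircle Real.pi, ℂ) where
  toFun := Function.Periodic.lift (f := fun x : ℝ => ((|Real.sin x| : ℝ) : ℂ)) (c := Real.pi)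
    fun x => by simp [Real.sin_add_pi]
  continuous_toFun := by
    refine continuous_quot_lift _ ?_
    fun_prop

theorem fourierCoeff_absSinCircle [Fact (0 < Real.pi)] (n : ℤ) :
    fourierCoeff absSinCircle n = 2 / (Real.pi * (1 - 4 * (n : ℂ) ^ 2)) := by
  rw [fourierCoeff_eq_intervalIntegral _ _ 0, zero_add]
  have : ∫ x in (0 : ℝ)..Real.pi, fourier (-n) (x : AddCircle Real.pi) • absSinCircle x
      = ∫ x in (0 : ℝ)..Real.pi, cexp ((-2 * n * I) * x) * (Real.sin x : ℂ) := by
    refine intervalIntegral.integral_congr fun x hx => ?_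
    rw [Set.uIcc_of_le Real.pi_pos.le] at hx
    have h1 : absSinCircle (x : AddCircle Real.pi) = ((|Real.sin x| : ℝ) : ℂ) := rfl
    simp only [h1, abs_of_nonneg (Real.sin_nonneg_of_nonneg_of_le_pi hx.1 hx.2), fourier_coe_apply,
      smul_eq_mul]
    congr 2
    have : (Real.pi : ℂ) ≠ 0 := by exact_mod_cast Real.pi_ne_zero
    push_cast
    field_simp
  rw [this, integral_exp_mul_sin, Complex.real_smul]
  push_cast
  rw [div_mul_div_comm, one_mul]

theorem summable_inv_four_mul_sq_sub_one :
    Summable fun n : ℕ => 1 / (4 * ((n : ℝ) + 1) ^ 2 - 1) := by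
  have h := (summable_nat_add_iff 1).2 (Real.summable_one_div_nat_pow (p := 2).2 one_lt_two)
  refine Summable.of_nonneg_of_le (fun n => ?_) (fun n => ?_) h
  · have : (0 : ℝ) ≤ n := n.cast_nonneg
    apply div_nonneg zero_le_one; nlinarith
  · have : (0 : ℝ) ≤ n := n.cast_nonneg
    push_cast
    apply one_div_le_one_div_of_le <;> nlinarith

theorem hasSum_abs_sin_int (x : ℝ) :
    HasSum (fun n : ℤ => 2 / (Real.pi * (1 - 4 * (n : ℝ) ^ 2)) * Real.cos (2 * n * x))
      |Real.sin x| := by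
  have : Fact (0 < Real.pi) := ⟨Real.pi_pos⟩
  have hs : Summable (fourierCoeff absSinCircle) := by
    have e : fourierCoeff absSinCircle
        = fun n : ℤ => ((2 / (Real.pi * (1 - 4 * (n : ℝ) ^ 2)) : ℝ) : ℂ) := by
      ext n; rw [fourierCoeff_absSinCircle]; push_cast; rfl
    rw [e]
    have key : Summable fun n : ℕ => 2 / (Real.pi * (1 - 4 * (n : ℝ) ^ 2)) := by
      rw [← summable_nat_add_iff 1]
      refine (summable_inv_four_mul_sq_sub_one.mul_left (-(2 / Real.pi))).congr fun n => ?_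
      have : (4 * ((n : ℝ) + 1) ^ 2 - 1) ≠ 0 := by
        have : (0 : ℝ) ≤ n := n.cast_nonneg
        nlinarith
      have h2 : (1 - 4 * ((n : ℝ) + 1) ^ 2) ≠ 0 := fun h => this (by linarith)
      have := Real.pi_ne_zero
      push_cast
      field_simp
      ring
    refine (Complex.ofRealCLM.summable (f := fun n : ℤ => 2 / (Real.pi * (1 - 4 * (n : ℝ) ^ 2))) ?_)
    refine Summable.of_nat_of_neg (by simpa using key) (by simpa using key)
  have h := has_pointwise_sum_fourier_series_of_summable hs (x : AddCircle Real.pi)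
  have h' := Complex.reCLM.hasSum h
  convert! h' using 1
  · ext n
    rw [fourierCoeff_absSinCircle, fourier_coe_apply]
    have e1 : (2 / (Real.pi * (1 - 4 * (n : ℂ) ^ 2)) : ℂ)
      = ((2 / (Real.pi * (1 - 4 * (n : ℝ) ^ 2)) : ℝ) : ℂ) := by push_cast; rfl
    have e2 : (2 * Real.pi * I * n * x / Real.pi : ℂ) = ((2 * n * x : ℝ) : ℂ) * I := by
      have : (Real.pi : ℂ) ≠ 0 := by exact_mod_cast Real.pi_ne_zero
      push_cast
      field_simp
    rw [e1, e2, smul_eq_mul, Complex.reCLM_apply, Complex.re_ofReal_mul, Complex.exp_ofReal_mul_I_re]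

/-- The coefficients in the expansion of `|sin|` as a series of squares of sines. -/
noncomputable def absSinCoeff (n : ℕ) : ℝ := 8 / Real.pi * (1 / (4 * ((n : ℝ) + 1) ^ 2 - 1))

theorem four_mul_sq_sub_one_pos (n : ℕ) : 0 < 4 * ((n : ℝ) + 1) ^ 2 - 1 := by
  have : (0 : ℝ) ≤ n := n.cast_nonneg
  nlinarith

theorem absSinCoeff_nonneg (n : ℕ) : 0 ≤ absSinCoeff n := by
  have := four_mul_sq_sub_one_pos n
  have := Real.pi_pos
  unfold absSinCoeff
  positivity

/-- The expansion of `|sin|` as a series of squares of sines. -/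
theorem hasSum_abs_sin (x : ℝ) :
    HasSum (fun n : ℕ => absSinCoeff n * Real.sin ((n + 1) * x) ^ 2) |Real.sin x| := by
  -- Subtracting the series at 0, where |sin| vanishes, turns each cosine into cos − 1 and so into a
  -- squared sine with a positive coefficient.
  have h := (hasSum_abs_sin_int x).sub (hasSum_abs_sin_int 0)
  rw [Real.sin_zero, abs_zero, sub_zero] at h
  have h2 := (hasSum_nat_add_iff' 1).2 h.nat_add_neg
  convert! h2 using 1
  · ext n
    have h1 := (four_mul_sq_sub_one_pos n).ne'
    have h2 : (1 - 4 * ((n : ℝ) + 1) ^ 2) ≠ 0 := fun h => h1 (by linarith)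
    have := Real.pi_ne_zero
    have e : Real.sin ((n + 1) * x) ^ 2 = (1 - Real.cos (2 * (n + 1) * x)) / 2 := by
      rw [mul_assoc, Real.cos_two_mul, Real.sin_sq]; ring
    rw [absSinCoeff, e]
    have e2 : 2 * -((n : ℝ) + 1) * x = -(2 * (n + 1) * x) := by ring
    push_cast
    rw [e2, Real.cos_neg]
    simp only [mul_zero, Real.cos_zero, neg_sq]
    field_simp
    ring
  · simp

theorem sum_range_inv_four_mul_sq_sub_one (L : ℕ) :
    ∑ n ∈ Finset.range L, 1 / (4 * ((n : ℝ) + 1) ^ 2 - 1) = (1 - 1 / (2 * (L : ℝ) + 1)) / 2 := by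
  induction L with
  | zero => simp
  | succ L ih =>
    rw [Finset.sum_range_succ, ih]
    have : (4 * ((L : ℝ) + 1) ^ 2 - 1) = (2 * L + 1) * (2 * (L + 1) + 1) := by ring
    rw [this]
    push_cast
    field_simp
    ring

theorem tsum_absSinCoeff_le : ∑' n, absSinCoeff n ≤ 4 / Real.pi := by
  unfold absSinCoeff
  rw [tsum_mul_left]
  have h : ∑' n : ℕ, 1 / (4 * ((n : ℝ) + 1) ^ 2 - 1) ≤ 1 / 2 := by
    refine Real.tsum_le_of_sum_range_le (fun n => ?_) fun L => ?_
    · exact (one_div_pos.2 (four_mul_sq_sub_one_pos n)).le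
    · rw [sum_range_inv_four_mul_sq_sub_one]
      have : (0 : ℝ) ≤ 1 / (2 * (L : ℝ) + 1) := by positivity
      linarith
  have := Real.pi_pos
  calc 8 / Real.pi * _ ≤ 8 / Real.pi * (1 / 2) := by gcongr
    _ = 4 / Real.pi := by ring

theorem summable_absSinCoeff : Summable absSinCoeff :=
  summable_inv_four_mul_sq_sub_one.mul_left _

/-! ### The Poisson kernel on high frequencies. -/

/-- The normalized Poisson kernel of the unit disc at the real point `q`. -/
noncomputable def circleKernel (q t : ℝ) : ℝ :=
  (2 * Real.pi)⁻¹ * poissonKernel 0 (q : ℂ) (circleMap 0 1 t)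

theorem circleKernel_eq (q t : ℝ) :
    circleKernel q t = (2 * Real.pi)⁻¹ * ((1 - q ^ 2) / ‖cexp (t * I) - q‖ ^ 2) := by
  simp [circleKernel, poissonKernel_def, circleMap]

theorem circleKernel_nonneg {q : ℝ} (h0 : 0 ≤ q) (h1 : q < 1) (t : ℝ) : 0 ≤ circleKernel q t := by
  rw [circleKernel_eq]
  have : 0 ≤ 1 - q ^ 2 := by nlinarith
  have := Real.pi_pos
  positivity

theorem continuous_circleKernel {q : ℝ} (h0 : 0 ≤ q) (h1 : q < 1) :
    Continuous (circleKernel q) := by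
  have e : circleKernel q
      = fun t : ℝ => (2 * Real.pi)⁻¹ * ((1 - q ^ 2) / ‖cexp (t * I) - q‖ ^ 2) := by
    ext t; exact circleKernel_eq q t
  rw [e]
  refine continuous_const.mul (continuous_const.div (by fun_prop) fun t => ?_)
  intro h
  have h2 : cexp (t * I) = q := by
    rw [← sub_eq_zero, ← norm_eq_zero]
    exact pow_eq_zero_iff (two_ne_zero) |>.1 h
  have h3 := congrArg norm h2
  rw [norm_exp_ofReal_mul_I, norm_real, Real.norm_of_nonneg h0] at h3
  exact h1.ne h3.symm

/-- The Poisson integral reproduces z^n at the point q; negative frequencies follow by conjugation.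
-/
theorem integral_circleKernel_mul_exp {q : ℝ} (h0 : 0 ≤ q) (h1 : q < 1) (k : ℤ) :
    ∫ t in (0 : ℝ)..(2 * Real.pi), (circleKernel q t : ℂ) * cexp ((k * t : ℝ) * I)
      = (q : ℂ) ^ k.natAbs := by
  have hnat : ∀ n : ℕ, ∫ t in (0 : ℝ)..(2 * Real.pi),
      (circleKernel q t : ℂ) * cexp (((n : ℤ) * t : ℝ) * I) = (q : ℂ) ^ n := by
    intro n
    have hd : DiffContOnCl ℂ (fun z : ℂ => z ^ n) (Metric.ball 0 1) :=
      (differentiable_id.pow n).diffContOnCl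
    have h := hd.circleAverage_poissonKernel_smul (w := (q : ℂ))
      (by simpa [abs_of_nonneg h0] using h1)
    rw [Real.circleAverage_def, ← intervalIntegral.integral_smul] at h
    rw [← h]
    refine intervalIntegral.integral_congr fun t _ => ?_
    simp only [circleKernel, Pi.smul_apply', Complex.real_smul, ofReal_mul,
      circleMap_zero, ofReal_one, one_mul, ← Complex.exp_nat_mul, mul_assoc]
    congr 2
  obtain ⟨n, rfl | rfl⟩ := k.eq_nat_or_neg
  · simpa using hnat n
  · have h := congrArg (starRingEnd ℂ) (hnat n)
    rw [map_pow, conj_ofReal] at h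
    rw [Int.natAbs_neg, Int.natAbs_natCast, ← h, intervalIntegral.integral_of_le (by positivity),
      intervalIntegral.integral_of_le (by positivity), ← integral_conj]
    congr 1 with t
    rw [map_mul, conj_ofReal, ← Complex.exp_conj, map_mul, conj_ofReal, conj_I]
    congr 2
    push_cast
    ring

theorem integral_circleKernel_mul_cos {q : ℝ} (h0 : 0 ≤ q) (h1 : q < 1) (k : ℤ) :
    ∫ t in (0 : ℝ)..(2 * Real.pi), circleKernel q t * Real.cos (k * t) = q ^ k.natAbs := by
  have hc := continuous_circleKernel h0 h1
  have h := congrArg Complex.re (integral_circleKernel_mul_exp h0 h1 k)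
  rw [← ofReal_pow, ofReal_re] at h
  rw [← h, ← Complex.reCLM_apply, ← ContinuousLinearMap.intervalIntegral_comp_comm]
  · refine intervalIntegral.integral_congr fun t _ => ?_
    simp only [Complex.reCLM_apply, Complex.re_ofReal_mul, Complex.exp_ofReal_mul_I_re]
  · apply Continuous.intervalIntegrable
    fun_prop

/-- Expanding |cos Nt| = |sin(Nt + π/2)| in squared sines, each square has Poisson mean at most (1 +
q^(2N))/2, the value attained by the first term; the coefficients sum to at most 4/π. -/
theorem integral_circleKernel_mul_abs_cos_le {q : ℝ} (h0 : 0 ≤ q) (h1 : q < 1) (N : ℕ) :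
    ∫ t in (0 : ℝ)..(2 * Real.pi), circleKernel q t * |Real.cos (N * t)|
      ≤ 2 / Real.pi * (1 + q ^ (2 * N)) := by
  have hc := continuous_circleKernel h0 h1
  have h2pi : (0 : ℝ) ≤ 2 * Real.pi := by positivity
  have hone : ∫ t in (0 : ℝ)..(2 * Real.pi), circleKernel q t = 1 := by
    simpa using integral_circleKernel_mul_cos h0 h1 0
  have hsin : ∀ (j : ℕ) (t : ℝ), Real.sin ((j + 1) * (N * t + Real.pi / 2)) ^ 2
      = (1 - (-1) ^ (j + 1) * Real.cos (((2 * (j + 1) * N : ℕ) : ℤ) * t)) / 2 := by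
    intro j t
    have e : 2 * (((j : ℝ) + 1) * (N * t + Real.pi / 2))
      = ((2 * (j + 1) * N : ℕ) : ℤ) * t + (j + 1 : ℕ) * Real.pi := by push_cast; ring
    rw [Real.sin_sq_eq_half_sub, e, Real.cos_add_nat_mul_pi]
    ring
  have hterm : ∀ j : ℕ, ∫ t in (0 : ℝ)..(2 * Real.pi),
      circleKernel q t * (absSinCoeff j * Real.sin ((j + 1) * (N * t + Real.pi / 2)) ^ 2)
        = absSinCoeff j * ((1 - (-1) ^ (j + 1) * q ^ (2 * (j + 1) * N)) / 2) := by
    intro j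
    have e : ∀ t, circleKernel q t *
        (absSinCoeff j * Real.sin ((j + 1) * (N * t + Real.pi / 2)) ^ 2)
        = absSinCoeff j / 2 * circleKernel q t - absSinCoeff j / 2 * (-1) ^ (j + 1) *
          (circleKernel q t * Real.cos (((2 * (j + 1) * N : ℕ) : ℤ) * t)) := by
      intro t; rw [hsin]; ring
    simp_rw [e]
    rw [intervalIntegral.integral_sub (by apply Continuous.intervalIntegrable; fun_prop)
      (by apply Continuous.intervalIntegrable; fun_prop), intervalIntegral.integral_const_mul,
      intervalIntegral.integral_const_mul, hone, integral_circleKernel_mul_cos h0 h1,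
      Int.natAbs_natCast]
    ring
  have hsum : HasSum (fun j : ℕ => ∫ t in (0 : ℝ)..(2 * Real.pi),
      circleKernel q t * (absSinCoeff j * Real.sin ((j + 1) * (N * t + Real.pi / 2)) ^ 2))
      (∫ t in (0 : ℝ)..(2 * Real.pi), circleKernel q t * |Real.cos (N * t)|) := by
    refine intervalIntegral.hasSum_integral_of_dominated_convergence
      (fun j t => circleKernel q t * absSinCoeff j) (fun j => ?_) (fun j => ?_) ?_ ?_ ?_
    · exact (Continuous.aestronglyMeasurable (by fun_prop))
    · refine Filter.Eventually.of_forall fun t _ => ?_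
      have h3 := circleKernel_nonneg h0 h1 t
      have h4 := absSinCoeff_nonneg j
      rw [Real.norm_of_nonneg (by positivity)]
      gcongr
      exact mul_le_of_le_one_right h4 (Real.sin_sq_le_one _)
    · exact Filter.Eventually.of_forall fun t _ => summable_absSinCoeff.mul_left _
    · simp_rw [tsum_mul_left]
      apply Continuous.intervalIntegrable
      fun_prop
    · refine Filter.Eventually.of_forall fun t _ => ?_
      rw [← Real.sin_add_pi_div_two]
      exact (hasSum_abs_sin _).mul_left _
  rw [← hsum.tsum_eq]
  simp_rw [hterm]
  have hle : ∀ j : ℕ, absSinCoeff j * ((1 - (-1) ^ (j + 1) * q ^ (2 * (j + 1) * N)) / 2)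
      ≤ absSinCoeff j * ((1 + q ^ (2 * N)) / 2) := by
    intro j
    refine mul_le_mul_of_nonneg_left ?_ (absSinCoeff_nonneg j)
    have h3 : q ^ (2 * (j + 1) * N) ≤ q ^ (2 * N) :=
      pow_le_pow_of_le_one h0 h1.le (by nlinarith)
    have h4 : (0 : ℝ) ≤ q ^ (2 * (j + 1) * N) := by positivity
    rcases neg_one_pow_eq_or ℝ (j + 1) with h | h <;> rw [h] <;> linarith
  have hsum2 := summable_absSinCoeff.mul_right ((1 + q ^ (2 * N)) / 2)
  have hs1 : Summable fun j : ℕ =>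
      absSinCoeff j * ((1 - (-1) ^ (j + 1) * q ^ (2 * (j + 1) * N)) / 2) := by
    simpa only [hterm] using hsum.summable
  refine (hs1.tsum_le_tsum hle hsum2).trans ?_
  rw [tsum_mul_right]
  calc (∑' j, absSinCoeff j) * ((1 + q ^ (2 * N)) / 2)
      ≤ 4 / Real.pi * ((1 + q ^ (2 * N)) / 2) := by
        gcongr
        exact tsum_absSinCoeff_le
    _ = _ := by ring

/-- The harmonic Schwarz lemma: the Poisson semigroup decays on high frequencies. -/
theorem multiplierBound_pow_natAbs {q : ℝ} (h0 : 0 ≤ q) (h1 : q < 1) (N : ℕ) :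
    MultiplierBound {k : ℤ | N ≤ k.natAbs} (fun k => (q : ℂ) ^ k.natAbs) (4 / Real.pi * q ^ N) := by
  have hc := continuous_circleKernel h0 h1
  have h2pi : (0 : ℝ) ≤ 2 * Real.pi := by positivity
  -- Multiplying the kernel by cos Nt replaces q^m, for m ≥ N, by (q^(m+N) + q^(m−N))/2, a fixed
  -- multiple of q^m; a undoes that multiple. Coefficients below N change freely, which is what
  -- allows a smaller L¹ norm.
  set a : ℝ := 2 * q ^ N / (1 + q ^ (2 * N)) with ha
  have ha0 : 0 ≤ a := by positivity
  have hK : Continuous fun t => a * (circleKernel q t * Real.cos (N * t)) := by fun_prop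
  have key := MultiplierBound.kernel (s := {k : ℤ | N ≤ k.natAbs})
    (volume.restrict (Set.Ioc 0 (2 * Real.pi)))
    (K := fun t => a * (circleKernel q t * Real.cos (N * t)))
    ((intervalIntegrable_iff_integrableOn_Ioc_of_le h2pi).1 (hK.intervalIntegrable _ _))
  refine (key.mono ?_).congr fun k hk => ?_
  · have e : ∀ t, |a * (circleKernel q t * Real.cos (N * t))|
        = a * (circleKernel q t * |Real.cos (N * t)|) := fun t => by
      rw [abs_mul, abs_mul, abs_of_nonneg ha0, abs_of_nonneg (circleKernel_nonneg h0 h1 t)]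
    simp_rw [e]
    rw [integral_const_mul, ← intervalIntegral.integral_of_le h2pi]
    calc _ ≤ a * (2 / Real.pi * (1 + q ^ (2 * N))) := by
          gcongr
          exact integral_circleKernel_mul_abs_cos_le h0 h1 N
      _ = _ := by
        rw [ha]
        have : (1 + q ^ (2 * N)) ≠ 0 := by positivity
        field_simp
        ring
  · rw [← intervalIntegral.integral_of_le h2pi]
    have e : ∀ t : ℝ, ((a * (circleKernel q t * Real.cos (N * t)) : ℝ) : ℂ)
          * cexp ((k * t : ℝ) * I)
        = a / 2 * (circleKernel q t * cexp (((k + N : ℤ) * t : ℝ) * I))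
          + a / 2 * (circleKernel q t * cexp (((k - N : ℤ) * t : ℝ) * I)) := by
      intro t
      have e1 : (((k + N : ℤ) * t : ℝ) * I : ℂ) = (k * t : ℝ) * I + (N * t : ℝ) * I := by
        push_cast; ring
      have e2 : (((k - N : ℤ) * t : ℝ) * I : ℂ) = (k * t : ℝ) * I + -((N * t : ℝ)) * I := by
        push_cast; ring
      rw [e1, e2, Complex.exp_add, Complex.exp_add, ofReal_mul, ofReal_mul, ofReal_cos, Complex.cos]
      ring
    simp_rw [e]
    rw [intervalIntegral.integral_add (by apply Continuous.intervalIntegrable; fun_prop)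
      (by apply Continuous.intervalIntegrable; fun_prop), intervalIntegral.integral_const_mul,
      intervalIntegral.integral_const_mul, integral_circleKernel_mul_exp h0 h1,
      integral_circleKernel_mul_exp h0 h1]
    have hk' : N ≤ k.natAbs := hk
    have hden : (1 + q ^ (2 * N)) ≠ 0 := by positivity
    have hmain : ∀ m : ℕ, N ≤ m → a / 2 * (q ^ (m + N) + q ^ (m - N)) = q ^ m := by
      intro m hm
      obtain ⟨d, rfl⟩ := Nat.exists_eq_add_of_le hm
      rw [ha, Nat.add_sub_cancel_left]
      field_simp
      ring
    have hsum : a / 2 * (q ^ (k + N : ℤ).natAbs + q ^ (k - N : ℤ).natAbs) = q ^ k.natAbs := by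
      rcases le_total 0 k with h | h
      · have e1 : (k + N : ℤ).natAbs = k.natAbs + N := by omega
        have e2 : (k - N : ℤ).natAbs = k.natAbs - N := by omega
        rw [e1, e2, hmain _ hk']
      · have e1 : (k + N : ℤ).natAbs = k.natAbs - N := by omega
        have e2 : (k - N : ℤ).natAbs = k.natAbs + N := by omega
        rw [e1, e2, add_comm, hmain _ hk']
    rw [← mul_add]
    exact_mod_cast hsum

/-! ### Integrals of sinc² and of products of squared sines. -/

theorem integral_one_sub_mul_cos {y : ℝ} (hy : y ≠ 0) :
    ∫ t in (0 : ℝ)..1, (1 - t) * Real.cos (y * t) = (1 - Real.cos y) / y ^ 2 := by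
  have hd : ∀ t ∈ Set.uIcc (0 : ℝ) 1, HasDerivAt
      (fun t : ℝ => (1 - t) * (Real.sin (y * t) / y) - Real.cos (y * t) / y ^ 2)
      ((1 - t) * Real.cos (y * t)) t := by
    intro t _
    have hl : HasDerivAt (fun t : ℝ => y * t) (y * 1) t := (hasDerivAt_id t).const_mul y
    have := (((hasDerivAt_id t).const_sub 1).mul (hl.sin.div_const y)).sub
      (hl.cos.div_const (y ^ 2))
    convert! this using 1
    simp only [id]
    field_simp
    ring
  rw [intervalIntegral.integral_eq_sub_of_hasDerivAt hd
    (by apply Continuous.intervalIntegrable; fun_prop)]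
  simp
  field_simp
  ring

theorem sinc_sq_eq {w : ℝ} : Real.sinc w ^ 2 =
    2 * ∫ t in (0 : ℝ)..1, (1 - t) * Real.cos (2 * w * t) := by
  rcases eq_or_ne w 0 with rfl | hw
  · have h : ∫ t in (0 : ℝ)..1, (1 - t) = 1 / 2 := by
      rw [intervalIntegral.integral_sub (by simp) (by simp)]
      norm_num
    simp [h]
  · rw [integral_one_sub_mul_cos (by simpa using hw), Real.sinc_of_ne_zero hw, div_pow,
      Real.sin_sq_eq_half_sub]
    field_simp

/-- The triangle function. -/
noncomputable def triangle (x : ℝ) : ℂ := ((max 0 (1 - |x|) : ℝ) : ℂ)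

theorem continuous_triangle : Continuous triangle := by
  unfold triangle
  fun_prop

theorem integral_triangle_mul {g : ℝ → ℂ} :
    ∫ x, g x * triangle x = ∫ x in (-1 : ℝ)..1, g x * triangle x := by
  rw [intervalIntegral.integral_of_le (by norm_num), ← integral_Icc_eq_integral_Ioc]
  refine (setIntegral_eq_integral_of_forall_compl_eq_zero fun x hx => ?_).symm
  have : 1 < |x| := by
    by_contra h
    exact hx (abs_le.1 (not_lt.1 h))
  rw [triangle, max_eq_left (by linarith)]
  simp

theorem integrable_triangle : Integrable triangle := by
  refine continuous_triangle.integrable_of_hasCompactSupport ?_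
  refine HasCompactSupport.intro (K := Set.Icc (-1) 1) isCompact_Icc fun x hx => ?_
  have : 1 < |x| := by
    by_contra h
    exact hx (abs_le.1 (not_lt.1 h))
  rw [triangle, max_eq_left (by linarith)]
  simp

theorem fourier_triangle (w : ℝ) : 𝓕 triangle w = ((Real.sinc (Real.pi * w) ^ 2 : ℝ) : ℂ) := by
  rw [Real.fourier_real_eq_integral_exp_smul]
  simp only [smul_eq_mul]
  rw [integral_triangle_mul]
  set F : ℝ → ℂ := fun v => cexp (((-2 * Real.pi * v * w : ℝ) : ℂ) * I) * triangle v with hF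
  have hFc : Continuous F := by
    have := continuous_triangle
    fun_prop
  have hneg : ∫ v in (-1 : ℝ)..0, F v = ∫ v in (0 : ℝ)..1, F (-v) := by
    rw [intervalIntegral.integral_comp_neg, neg_zero]
  rw [← intervalIntegral.integral_add_adjacent_intervals (hFc.intervalIntegrable (-1) 0)
    (hFc.intervalIntegrable 0 1), hneg, ← intervalIntegral.integral_add (f := fun v => F (-v))
    ((hFc.comp continuous_neg).intervalIntegrable 0 1) (hFc.intervalIntegrable 0 1), sinc_sq_eq,
    ofReal_mul, ← intervalIntegral.integral_ofReal, ← intervalIntegral.integral_const_mul]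
  refine intervalIntegral.integral_congr fun v hv => ?_
  rw [Set.uIcc_of_le zero_le_one] at hv
  have h1 : triangle v = ((1 - v : ℝ) : ℂ) := by
    rw [triangle, abs_of_nonneg hv.1, max_eq_right (by linarith [hv.2])]
  have h2 : triangle (-v) = ((1 - v : ℝ) : ℂ) := by
    rw [← h1, triangle, triangle, abs_neg]
  simp only [hF, h1, h2]
  have e1 : ((-2 * Real.pi * -v * w : ℝ) : ℂ) * I = ((2 * (Real.pi * w) * v : ℝ) : ℂ) * I := by
    push_cast; ring
  have e2 : ((-2 * Real.pi * v * w : ℝ) : ℂ) * I = -((2 * (Real.pi * w) * v : ℝ) : ℂ) * I := by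
    push_cast; ring
  rw [e1, e2, ofReal_mul (1 - v), ofReal_cos, Complex.cos]
  push_cast
  ring

theorem integrable_sinc_sq : Integrable fun x : ℝ => Real.sinc x ^ 2 := by
  refine (integrable_inv_one_add_sq.const_mul 2).mono'
    (Real.continuous_sinc.pow 2).aestronglyMeasurable (Filter.Eventually.of_forall fun x => ?_)
  rw [Real.norm_of_nonneg (sq_nonneg _), ← div_eq_mul_inv, le_div_iff₀ (by positivity)]
  have h1 : Real.sinc x ^ 2 ≤ 1 := by
    rw [sq_le_one_iff_abs_le_one]
    exact Real.abs_sinc_le_one x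
  have h2 : Real.sinc x ^ 2 * x ^ 2 ≤ 1 := by
    rcases eq_or_ne x 0 with rfl | hx
    · simp
    · rw [Real.sinc_of_ne_zero hx, div_pow, div_mul_cancel₀ _ (by positivity)]
      exact Real.sin_sq_le_one x
  linarith

/-- Fourier inversion for the triangle function, evaluated at 0. -/
theorem integral_sinc_sq : ∫ x, Real.sinc x ^ 2 = Real.pi := by
  have hF : 𝓕 triangle = fun w => ((Real.sinc (Real.pi * w) ^ 2 : ℝ) : ℂ) :=
    funext fourier_triangle
  have hint : Integrable (𝓕 triangle) := by
    rw [hF]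
    exact (integrable_sinc_sq.comp_mul_left' Real.pi_ne_zero).ofReal
  have h := congrFun (continuous_triangle.fourierInv_fourier_eq integrable_triangle hint) 0
  rw [Real.fourierInv_eq'] at h
  simp only [hF, inner_zero_right, mul_zero, ofReal_zero, zero_mul, Complex.exp_zero,
    one_smul] at h
  rw [integral_complex_ofReal] at h
  have h2 : ∫ w, Real.sinc (Real.pi * w) ^ 2 = 1 := by
    have : triangle 0 = 1 := by simp [triangle]
    rw [this] at h
    exact_mod_cast h
  rw [Measure.integral_comp_mul_left (fun x => Real.sinc x ^ 2), abs_of_pos (by positivity),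
    smul_eq_mul] at h2
  field_simp at h2
  exact h2

theorem one_sub_cos_div_sq_ae_eq (y : ℝ) :
    (fun t : ℝ => (1 - Real.cos (y * t)) / t ^ 2)
      =ᵐ[volume] fun t => y ^ 2 / 2 * Real.sinc (y / 2 * t) ^ 2 := by
  filter_upwards [compl_mem_ae_iff.2 (measure_singleton (0 : ℝ))] with t ht
  have ht : t ≠ 0 := ht
  rcases eq_or_ne y 0 with rfl | hy
  · simp
  have h : y / 2 * t ≠ 0 := by positivity
  have e : 2 * (y / 2 * t) = y * t := by ring
  rw [Real.sinc_of_ne_zero h, div_pow, Real.sin_sq_eq_half_sub, e]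
  field_simp

theorem integrable_one_sub_cos_div_sq (y : ℝ) :
    Integrable fun t : ℝ => (1 - Real.cos (y * t)) / t ^ 2 := by
  refine Integrable.congr ?_ (one_sub_cos_div_sq_ae_eq y).symm
  rcases eq_or_ne y 0 with rfl | hy
  · simp
  exact (integrable_sinc_sq.comp_mul_left' (by positivity)).const_mul _

theorem integral_one_sub_cos_div_sq (y : ℝ) :
    ∫ t : ℝ, (1 - Real.cos (y * t)) / t ^ 2 = Real.pi * |y| := by
  rw [integral_congr_ae (one_sub_cos_div_sq_ae_eq y), integral_const_mul]
  rcases eq_or_ne y 0 with rfl | hy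
  · simp
  rw [Measure.integral_comp_mul_left (fun x => Real.sinc x ^ 2), integral_sinc_sq, smul_eq_mul,
    abs_inv, abs_div, abs_two, ← sq_abs]
  have : |y| ≠ 0 := abs_ne_zero.2 hy
  field_simp

theorem sin_sq_mul_sin_sq (a b t : ℝ) : Real.sin (a * t) ^ 2 * Real.sin (b * t) ^ 2 / t ^ 2
    = 1 / 4 * ((1 - Real.cos (2 * a * t)) / t ^ 2) + 1 / 4 * ((1 - Real.cos (2 * b * t)) / t ^ 2)
      - 1 / 8 * ((1 - Real.cos ((2 * a + 2 * b) * t)) / t ^ 2)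
      - 1 / 8 * ((1 - Real.cos ((2 * a - 2 * b) * t)) / t ^ 2) := by
  have e1 : (2 * a + 2 * b) * t = 2 * (a * t) + 2 * (b * t) := by ring
  have e2 : (2 * a - 2 * b) * t = 2 * (a * t) - 2 * (b * t) := by ring
  rw [Real.sin_sq_eq_half_sub, Real.sin_sq_eq_half_sub, e1, e2, Real.cos_add, Real.cos_sub,
    mul_assoc 2 a t, mul_assoc 2 b t]
  ring

theorem integrable_sin_sq_mul_sin_sq_div_sq (a b : ℝ) :
    Integrable fun t : ℝ => Real.sin (a * t) ^ 2 * Real.sin (b * t) ^ 2 / t ^ 2 := by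
  simp_rw [sin_sq_mul_sin_sq]
  exact ((((integrable_one_sub_cos_div_sq _).const_mul _).add
    ((integrable_one_sub_cos_div_sq _).const_mul _)).sub
    ((integrable_one_sub_cos_div_sq _).const_mul _)).sub
    ((integrable_one_sub_cos_div_sq _).const_mul _)

/-- The product splits into four terms (1 − cos yt)/t², each integrating to π|y|; the absolute
values of the sum and the difference combine into the minimum. -/
theorem integral_sin_sq_mul_sin_sq_div_sq {a b : ℝ} (ha : 0 ≤ a) (hb : 0 ≤ b) :
    ∫ t : ℝ, Real.sin (a * t) ^ 2 * Real.sin (b * t) ^ 2 / t ^ 2 = Real.pi / 2 * min a b := by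
  simp_rw [sin_sq_mul_sin_sq]
  have h := fun c y : ℝ => (integrable_one_sub_cos_div_sq y).const_mul c
  have h2 : Integrable fun t : ℝ => 1 / 4 * ((1 - Real.cos (2 * a * t)) / t ^ 2)
      + 1 / 4 * ((1 - Real.cos (2 * b * t)) / t ^ 2) := (h _ _).add (h _ _)
  have h3 : Integrable fun t : ℝ => 1 / 4 * ((1 - Real.cos (2 * a * t)) / t ^ 2)
      + 1 / 4 * ((1 - Real.cos (2 * b * t)) / t ^ 2)
      - 1 / 8 * ((1 - Real.cos ((2 * a + 2 * b) * t)) / t ^ 2) := h2.sub (h _ _)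
  rw [integral_sub h3 (h _ _), integral_sub h2 (h _ _), integral_add (h _ _) (h _ _)]
  simp only [integral_const_mul, integral_one_sub_cos_div_sq]
  rw [abs_of_nonneg (by positivity : 0 ≤ 2 * a), abs_of_nonneg (by positivity : 0 ≤ 2 * b),
    abs_of_nonneg (by positivity : 0 ≤ 2 * a + 2 * b)]
  rcases le_total a b with hab | hab
  · rw [min_eq_left hab, abs_of_nonpos (by linarith)]; ring
  · rw [min_eq_right hab, abs_of_nonneg (by linarith)]; ring

/-! ### Elementary sums with logarithmic bounds. -/

theorem log_succ_sub_log_le {L : ℝ} (hL : 0 < L) :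
    Real.log (L + 1) - Real.log L ≤ (2 * L + 1) / (2 * L * (L + 1)) := by
  have h1 : 1 ≤ (L + 1) / L := by rw [le_div_iff₀ hL]; linarith
  have h := Real.self_le_sinh_iff.2 (Real.log_nonneg h1)
  rw [Real.sinh_log (by positivity), Real.log_div (by positivity) hL.ne'] at h
  refine h.trans_eq ?_
  field_simp
  ring

theorem le_log_succ_sub_log {L : ℝ} (hL : 0 < L) :
    2 / (2 * L + 1) ≤ Real.log (L + 1) - Real.log L := by
  have h := Real.le_log_one_add_of_nonneg (x := 1 / L) (by positivity)
  have e : 1 + 1 / L = (L + 1) / L := by field_simp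
  rw [e, Real.log_div (by positivity) hL.ne'] at h
  refine le_trans (le_of_eq ?_) h
  field_simp
  ring

/-- Summation by parts: 1/(4j² − 1) is a difference of the numbers 1/(2(2j ∓ 1)), and the increments
of the logarithm are small enough to leave the telescoping series of 1/(4L(L + 1)). The two
subtracted terms in `key` are what remains at each end. -/
theorem sum_range_log_mul_le (L : ℕ) :
    ∑ j ∈ Finset.range L, Real.log (j + 1) * (1 / (4 * ((j : ℝ) + 1) ^ 2 - 1)) ≤ 1 / 4 := by
  rcases Nat.eq_zero_or_pos L with rfl | hL
  · norm_num
  have key : ∑ j ∈ Finset.range L, Real.log (j + 1) * (1 / (4 * ((j : ℝ) + 1) ^ 2 - 1))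
      ≤ 1 / 4 - 1 / (4 * L) - Real.log L / (2 * (2 * L + 1)) := by
    induction L, hL using Nat.le_induction with
    | base => norm_num
    | succ L hL ih =>
      rw [Finset.sum_range_succ]
      have hL' : (0 : ℝ) < L := by exact_mod_cast hL
      have h := log_succ_sub_log_le hL'
      have h1 : (Real.log (L + 1) - Real.log L) / (2 * (2 * L + 1)) ≤ 1 / (4 * L * (L + 1)) := by
        rw [div_le_iff₀ (by positivity)]
        refine h.trans_eq ?_
        field_simp
        ring
      have e1 : (1 : ℝ) / (4 * L * (L + 1)) = 1 / (4 * L) - 1 / (4 * (L + 1)) := by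
        field_simp
        ring
      have e2 : Real.log (L + 1) * (1 / (4 * ((L : ℝ) + 1) ^ 2 - 1))
          = Real.log (L + 1) / (2 * (2 * L + 1)) - Real.log (L + 1) / (2 * (2 * (L + 1) + 1)) := by
        have : (4 * ((L : ℝ) + 1) ^ 2 - 1) = (2 * L + 1) * (2 * (L + 1) + 1) := by ring
        rw [this]
        field_simp
        ring
      have e3 : (Real.log (L + 1) - Real.log L) / (2 * (2 * L + 1))
        = Real.log (L + 1) / (2 * (2 * L + 1)) - Real.log L / (2 * (2 * L + 1)) := sub_div _ _ _
      push_cast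
      linarith
  have h1 : (0 : ℝ) ≤ 1 / (4 * L) := by positivity
  have h2 : (0 : ℝ) ≤ Real.log L / (2 * (2 * L + 1)) :=
    div_nonneg (Real.log_natCast_nonneg L) (by positivity)
  linarith

theorem sum_range_odd_inv_le (l : ℕ) (hl : 1 ≤ l) :
    2 * ∑ m ∈ Finset.range l, 1 / (2 * (m : ℝ) + 1) ≤ Real.log (l + 1) + 1.967 := by
  have hlog2 := Real.log_two_gt_d9
  have hlog4 : Real.log 4 = 2 * Real.log 2 := by
    rw [show (4 : ℝ) = 2 ^ 2 by norm_num, Real.log_pow]; norm_num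
  have hlog3 : 1 < Real.log 3 := by
    rw [Real.lt_log_iff_exp_lt (by norm_num)]
    exact Real.exp_one_lt_d9.trans (by norm_num)
  rcases le_or_gt 4 l with h4 | h4
  -- The induction needs log l, since the increment 2/(2l + 1) is at most log(l + 1) − log l but
  -- exceeds the next logarithmic increment. With log l the constant 1.967 holds only from l = 4;
  -- smaller l need the slack of log(l + 1).
  · have key : 2 * ∑ m ∈ Finset.range l, 1 / (2 * (m : ℝ) + 1) ≤ Real.log l + 1.967 := by
      induction l, h4 using Nat.le_induction with
      | base =>
        norm_num [Finset.sum_range_succ]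
        linarith
      | succ l h4 ih =>
        have hl' : (0 : ℝ) < l := by exact_mod_cast (by omega : 0 < l)
        have h := le_log_succ_sub_log hl'
        have ih := ih (by omega)
        rw [Finset.sum_range_succ]
        have e : (2 : ℝ) / (2 * l + 1) = 2 * (1 / (2 * l + 1)) := by ring
        push_cast
        linarith
    have hl' : (0 : ℝ) < l := by exact_mod_cast hl
    have : Real.log l ≤ Real.log (l + 1) := Real.log_le_log hl' (by linarith)
    linarith
  · interval_cases l
    · norm_num
      linarith
    · norm_num [Finset.sum_range_succ]
      linarith
    · norm_num [Finset.sum_range_succ]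
      linarith

theorem sum_range_tail_le (l L : ℕ) :
    ∑ i ∈ Finset.range L, (if l ≤ i then 1 / (4 * ((i : ℝ) + 1) ^ 2 - 1) else 0)
      ≤ 1 / 2 * (1 / (2 * (l : ℝ) + 1)) := by
  rcases le_total L l with h | h
  · rw [Finset.sum_eq_zero]
    · positivity
    · intro i hi
      rw [if_neg (by have := Finset.mem_range.1 hi; omega)]
  · rw [← Finset.sum_filter]
    have e : (Finset.range L).filter (fun i => l ≤ i) = Finset.Ico l L := by
      ext i; simp [and_comm]
    rw [e, Finset.sum_Ico_eq_sub _ h, sum_range_inv_four_mul_sq_sub_one,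
      sum_range_inv_four_mul_sq_sub_one]
    have : (0 : ℝ) ≤ 1 / (2 * (L : ℝ) + 1) := by positivity
    linarith

/-- Layer-cake summation: raising l by one adds a tail of the telescoping series of 1/(4(i + 1)² −
1). -/
theorem sum_range_min_nat_le (L l : ℕ) :
    ∑ i ∈ Finset.range L, min (l : ℝ) (i + 1) * (1 / (4 * ((i : ℝ) + 1) ^ 2 - 1))
      ≤ 1 / 2 * ∑ m ∈ Finset.range l, 1 / (2 * (m : ℝ) + 1) := by
  induction l with
  | zero =>
    refine (Finset.sum_eq_zero fun i _ => ?_).le.trans (by simp)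
    rw [Nat.cast_zero, min_eq_left (by positivity), zero_mul]
  | succ l ih =>
    rw [Finset.sum_range_succ, mul_add]
    refine le_trans (le_of_eq ?_) (add_le_add ih (sum_range_tail_le l L))
    rw [← Finset.sum_add_distrib]
    refine Finset.sum_congr rfl fun i _ => ?_
    push_cast
    split_ifs with h
    · have h' : (l : ℝ) ≤ i := by exact_mod_cast h
      rw [min_eq_left (by linarith), min_eq_left (by linarith)]
      ring
    · have h' : (i : ℝ) + 1 ≤ l := by exact_mod_cast (by omega : i + 1 ≤ l)
      rw [min_eq_right (by linarith), min_eq_right (by linarith)]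
      ring

theorem min_interpolate {x : ℝ} {l i : ℕ} (h1 : l ≤ x) (h2 : x ≤ l + 1) :
    min x ((i : ℝ) + 1) = (1 - (x - l)) * min (l : ℝ) (i + 1)
      + (x - l) * min ((l + 1 : ℕ) : ℝ) (i + 1) := by
  push_cast
  rcases le_or_gt l i with h | h
  · have h' : (l : ℝ) ≤ i := by exact_mod_cast h
    rw [min_eq_left (by linarith), min_eq_left (by linarith), min_eq_left (by linarith)]
    ring
  · have h' : (i : ℝ) + 1 ≤ l := by exact_mod_cast h
    rw [min_eq_right (by linarith), min_eq_right (by linarith), min_eq_right (by linarith)]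
    ring

/-- The left side is affine in x between consecutive integers and the logarithm is concave, so the
integer case interpolates. -/
theorem sum_range_min_le (L : ℕ) {x : ℝ} (hx : 1 ≤ x) :
    ∑ i ∈ Finset.range L, min x (i + 1) * (1 / (4 * ((i : ℝ) + 1) ^ 2 - 1))
      ≤ (Real.log (x + 1) + 1.967) / 4 := by
  set l := ⌊x⌋₊ with hl
  have h1 : (l : ℝ) ≤ x := Nat.floor_le (by linarith)
  have h2 : x ≤ l + 1 := (Nat.lt_floor_add_one x).le
  have hl1 : 1 ≤ l := Nat.one_le_floor_iff x |>.2 hx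
  have hn : ∀ m : ℕ, 1 ≤ m →
      ∑ i ∈ Finset.range L, min (m : ℝ) (i + 1) * (1 / (4 * ((i : ℝ) + 1) ^ 2 - 1))
        ≤ (Real.log (m + 1) + 1.967) / 4 := fun m hm => by
    have := sum_range_min_nat_le L m
    have := sum_range_odd_inv_le m hm
    linarith
  have hconc := (strictConcaveOn_log_Ioi.concaveOn).2
    (Set.mem_Ioi.2 (by positivity : (0 : ℝ) < (l : ℝ) + 1))
    (Set.mem_Ioi.2 (by positivity : (0 : ℝ) < (l : ℝ) + 1 + 1))
    (by linarith : (0 : ℝ) ≤ 1 - (x - l)) (by linarith : (0 : ℝ) ≤ x - l) (by ring)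
  simp only [smul_eq_mul] at hconc
  rw [show (1 - (x - l)) * ((l : ℝ) + 1) + (x - l) * (l + 1 + 1) = x + 1 by ring] at hconc
  simp_rw [min_interpolate h1 h2, add_mul, mul_assoc, Finset.sum_add_distrib, ← Finset.mul_sum]
  have ha := mul_le_mul_of_nonneg_left (hn l hl1) (by linarith : 0 ≤ 1 - (x - l))
  have hb := mul_le_mul_of_nonneg_left (hn (l + 1) (by omega)) (by linarith : 0 ≤ x - l)
  push_cast at ha hb ⊢
  refine (add_le_add ha hb).trans ?_
  linarith

/-! ### The L¹ norm of a product of two sines over t². -/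

theorem tsum_absSinCoeff_mul_min_le {A B : ℝ} (hB : 0 < B) (hAB : B ≤ A) (j : ℕ) :
    ∑' i, ENNReal.ofReal (absSinCoeff i * min ((j + 1) * A) ((i + 1) * B))
      ≤ ENNReal.ofReal (2 * B / Real.pi * (Real.log (j + 1) + Real.log (A / B + 1) + 1.967)) := by
  have hj : (0 : ℝ) ≤ j := j.cast_nonneg
  have hA : 0 < A := hB.trans_le hAB
  refine ENNReal.tsum_le_of_sum_range_le fun L => ?_
  rw [← ENNReal.ofReal_sum_of_nonneg]
  swap
  · intro i _
    have := absSinCoeff_nonneg i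
    positivity
  refine ENNReal.ofReal_le_ofReal ?_
  have hρ : 1 ≤ A / B := (one_le_div hB).2 hAB
  have hx : 1 ≤ (j + 1) * (A / B) := by nlinarith
  have h := sum_range_min_le L hx
  -- This separates j from A/B, since (j + 1)ρ + 1 ≤ (j + 1)(ρ + 1).
  have hlog : Real.log ((j + 1) * (A / B) + 1) ≤ Real.log (j + 1) + Real.log (A / B + 1) := by
    rw [← Real.log_mul (by positivity) (by positivity)]
    exact Real.log_le_log (by positivity) (by nlinarith)
  have e : ∀ i : ℕ, absSinCoeff i * min ((j + 1) * A) ((i + 1) * B)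
      = 8 * B / Real.pi * (min ((j + 1) * (A / B)) (i + 1) * (1 / (4 * ((i : ℝ) + 1) ^ 2 - 1))) := by
    intro i
    have : min ((j + 1) * A) ((i + 1) * B) = min ((j + 1) * (A / B)) (i + 1) * B := by
      rw [min_mul_of_nonneg _ _ hB.le, mul_assoc, div_mul_cancel₀ _ hB.ne']
    rw [this, absSinCoeff]
    ring
  simp_rw [e, ← Finset.mul_sum]
  calc _ ≤ 8 * B / Real.pi * ((Real.log (j + 1) + Real.log (A / B + 1) + 1.967) / 4) := by
        gcongr
        linarith
    _ = _ := by ring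

theorem tsum_tsum_absSinCoeff_le {A B : ℝ} (hB : 0 < B) (hAB : B ≤ A) :
    ∑' j, ∑' i, ENNReal.ofReal (absSinCoeff j * absSinCoeff i *
      (Real.pi / 2 * min ((j + 1) * A) ((i + 1) * B)))
      ≤ ENNReal.ofReal (4 * B / Real.pi * (Real.log (A / B + 1) + 2.467)) := by
  have hA : 0 < A := hB.trans_le hAB
  have hρ : 0 ≤ Real.log (A / B + 1) := Real.log_nonneg (by
    have : 0 < A / B := by positivity
    linarith)
  have hin : ∀ j : ℕ, ∑' i, ENNReal.ofReal (absSinCoeff j * absSinCoeff i *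
      (Real.pi / 2 * min ((j + 1) * A) ((i + 1) * B)))
      ≤ ENNReal.ofReal (absSinCoeff j * (B * (Real.log (j + 1) + Real.log (A / B + 1) + 1.967))) := by
    intro j
    have hj := absSinCoeff_nonneg j
    have e : ∀ i : ℕ, ENNReal.ofReal (absSinCoeff j * absSinCoeff i *
        (Real.pi / 2 * min ((j + 1) * A) ((i + 1) * B)))
        = ENNReal.ofReal (absSinCoeff j * (Real.pi / 2)) *
          ENNReal.ofReal (absSinCoeff i * min ((j + 1) * A) ((i + 1) * B)) := by
      intro i
      rw [← ENNReal.ofReal_mul (by positivity)]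
      congr 1
      ring
    simp_rw [e]
    rw [ENNReal.tsum_mul_left]
    refine (mul_le_mul_right (tsum_absSinCoeff_mul_min_le hB hAB j) _).trans ?_
    rw [← ENNReal.ofReal_mul (by positivity)]
    refine ENNReal.ofReal_le_ofReal (le_of_eq ?_)
    have := Real.pi_ne_zero
    field_simp
  refine (ENNReal.tsum_le_tsum hin).trans (ENNReal.tsum_le_of_sum_range_le fun L => ?_)
  rw [← ENNReal.ofReal_sum_of_nonneg]
  swap
  · intro j _
    have := absSinCoeff_nonneg j
    have : 0 ≤ Real.log ((j : ℝ) + 1) := Real.log_nonneg (by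
      have : (0 : ℝ) ≤ j := j.cast_nonneg
      linarith)
    positivity
  refine ENNReal.ofReal_le_ofReal ?_
  have e : ∀ j : ℕ, absSinCoeff j * (B * (Real.log (j + 1) + Real.log (A / B + 1) + 1.967))
      = 8 * B / Real.pi * (Real.log (j + 1) * (1 / (4 * ((j : ℝ) + 1) ^ 2 - 1)))
        + 8 * B / Real.pi * (Real.log (A / B + 1) + 1.967) *
          (1 / (4 * ((j : ℝ) + 1) ^ 2 - 1)) := by
    intro j
    rw [absSinCoeff]
    ring
  simp_rw [e, Finset.sum_add_distrib, ← Finset.mul_sum]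
  have h1 := sum_range_log_mul_le L
  have h2 : ∑ n ∈ Finset.range L, 1 / (4 * ((n : ℝ) + 1) ^ 2 - 1) ≤ 1 / 2 := by
    rw [sum_range_inv_four_mul_sq_sub_one]
    have : (0 : ℝ) ≤ 1 / (2 * (L : ℝ) + 1) := by positivity
    linarith
  calc _ ≤ 8 * B / Real.pi * (1 / 4)
        + 8 * B / Real.pi * (Real.log (A / B + 1) + 1.967) * (1 / 2) := by gcongr
    _ = _ := by ring

/-- Both sines are expanded in squares. All terms are nonnegative, so in extended nonnegative reals
the sums and the integral interchange with no integrability check. -/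
theorem lintegral_abs_sin_mul_abs_sin_le {A B : ℝ} (hB : 0 < B) (hAB : B ≤ A) :
    ∫⁻ t : ℝ, ENNReal.ofReal (|Real.sin (A * t)| * |Real.sin (B * t)| / t ^ 2)
      ≤ ENNReal.ofReal (4 * B / Real.pi * (Real.log (A / B + 1) + 2.467)) := by
  have hA : 0 < A := hB.trans_le hAB
  have hser : ∀ x : ℝ, ENNReal.ofReal |Real.sin x|
      = ∑' j : ℕ, ENNReal.ofReal (absSinCoeff j * Real.sin ((j + 1) * x) ^ 2) := fun x => by
    rw [← (hasSum_abs_sin x).tsum_eq, ENNReal.ofReal_tsum_of_nonneg _ (hasSum_abs_sin x).summable]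
    intro j
    have := absSinCoeff_nonneg j
    positivity
  have e : ∀ t : ℝ, ENNReal.ofReal (|Real.sin (A * t)| * |Real.sin (B * t)| / t ^ 2)
      = ∑' j : ℕ, ∑' i : ℕ, ENNReal.ofReal (absSinCoeff j * absSinCoeff i *
        (Real.sin ((j + 1) * A * t) ^ 2 * Real.sin ((i + 1) * B * t) ^ 2 / t ^ 2)) := by
    intro t
    rw [div_eq_mul_inv, ENNReal.ofReal_mul (by positivity), ENNReal.ofReal_mul (by positivity),
      hser, hser, mul_assoc, ← ENNReal.tsum_mul_right]
    refine tsum_congr fun j => ?_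
    rw [← ENNReal.tsum_mul_right, ← ENNReal.tsum_mul_left]
    refine tsum_congr fun i => ?_
    have := absSinCoeff_nonneg j
    have := absSinCoeff_nonneg i
    rw [← ENNReal.ofReal_mul (by positivity), ← ENNReal.ofReal_mul (by positivity)]
    congr 1
    rw [mul_assoc _ A, mul_assoc _ B]
    ring
  simp_rw [e]
  rw [lintegral_tsum fun j => ?_]
  swap
  · exact (Measurable.tsum fun i => by fun_prop).aemeasurable
  refine le_trans (le_of_eq ?_) (tsum_tsum_absSinCoeff_le hB hAB)
  refine tsum_congr fun j => ?_
  rw [lintegral_tsum fun i => by fun_prop]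
  refine tsum_congr fun i => ?_
  have := absSinCoeff_nonneg j
  have := absSinCoeff_nonneg i
  rw [← ofReal_integral_eq_lintegral_ofReal, integral_const_mul,
    integral_sin_sq_mul_sin_sq_div_sq (by positivity) (by positivity)]
  · exact (integrable_sin_sq_mul_sin_sq_div_sq _ _).const_mul _
  · exact Filter.Eventually.of_forall fun t => by positivity

theorem integral_abs_sin_mul_abs_sin_le {A B : ℝ} (hB : 0 < B) (hAB : B ≤ A) :
    ∫ t : ℝ, |Real.sin (A * t)| * |Real.sin (B * t)| / t ^ 2
      ≤ 4 * B / Real.pi * (Real.log (A / B + 1) + 2.467) := by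
  have hA : 0 < A := hB.trans_le hAB
  have hρ : 0 ≤ Real.log (A / B + 1) := Real.log_nonneg (by
    have : 0 < A / B := by positivity
    linarith)
  rw [integral_eq_lintegral_of_nonneg_ae (Filter.Eventually.of_forall fun t => by positivity)
    (Measurable.aestronglyMeasurable (by fun_prop))]
  exact ENNReal.toReal_le_of_le_ofReal (by positivity) (lintegral_abs_sin_mul_abs_sin_le hB hAB)

/-! ### Cosine kernels and the de la Vallée Poussin operator. -/

theorem MultiplierBound.cos {s : Set ℤ} (t : ℝ) :
    MultiplierBound s (fun k => (Real.cos (k * t) : ℂ)) 1 := by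
  have h1 := (MultiplierBound.exp (s := s) t).const_mul (1 / 2)
  have h2 := (MultiplierBound.exp (s := s) (-t)).const_mul (-(1 / 2))
  refine ((h1.sub h2).congr fun k _ => ?_).mono (by norm_num)
  rw [ofReal_cos, Complex.cos]
  have : -((k * t : ℝ) : ℂ) * I = ((k * -t : ℝ) : ℂ) * I := by push_cast; ring
  rw [this]
  ring

theorem MultiplierBound.cosKernel {s : Set ℤ} (μ : Measure ℝ) {K : ℝ → ℝ} (hK : Integrable K μ) :
    MultiplierBound s (fun k => ((∫ t, K t * Real.cos (k * t) ∂μ : ℝ) : ℂ)) (∫ t, |K t| ∂μ) := by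
  have h := MultiplierBound.integral (s := s) μ
    (l := fun t k => (K t : ℂ) * (Real.cos (k * t) : ℂ)) (B := fun t => |K t|)
    (Filter.Eventually.of_forall fun t => ?_) (fun k _ => ?_) hK.abs
  · refine h.congr fun k _ => ?_
    rw [← integral_complex_ofReal]
    simp only [ofReal_mul]
  · simpa using (MultiplierBound.cos t).const_mul (K t : ℂ)
  · refine (hK.ofReal (𝕜 := ℂ)).mul_bdd (c := 1) (by fun_prop)
      (Filter.Eventually.of_forall fun t => ?_)
    rw [norm_real]
    exact Real.abs_cos_le_one _

/-- The trapezoidal multiplier, equal to `1` on `[-N, N]` and to `0` outside `(-M, M)`. -/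
noncomputable def trapezoid (N M : ℝ) (k : ℤ) : ℂ :=
  (((max M |(k : ℝ)| - max N |(k : ℝ)|) / (M - N) : ℝ) : ℂ)

/-- Integrating (1 − cos yt)/t² at y = M ± k produces |M + k| + |M − k|; this identity puts it in
the form used by `trapezoid`. -/
theorem abs_add_add_abs_sub (a b : ℝ) (ha : 0 ≤ a) : |a + b| + |a - b| = 2 * max a |b| := by
  rcases le_total 0 b with hb | hb
  · rw [abs_of_nonneg hb, abs_of_nonneg (by linarith : 0 ≤ a + b)]
    rcases le_total a b with h | h
    · rw [max_eq_right h, abs_of_nonpos (by linarith)]; ring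
    · rw [max_eq_left h, abs_of_nonneg (by linarith)]; ring
  · rw [abs_of_nonpos hb, abs_of_nonneg (by linarith : 0 ≤ a - b)]
    rcases le_total a (-b) with h | h
    · rw [max_eq_right h, abs_of_nonpos (by linarith)]; ring
    · rw [max_eq_left h, abs_of_nonneg (by linarith)]; ring

/-- The norm of the operator of de la Vallée Poussin. -/
theorem multiplierBound_trapezoid {N M : ℝ} (hN : 0 ≤ N) (hNM : N < M) (s : Set ℤ) :
    MultiplierBound s (trapezoid N M)
      (4 / Real.pi ^ 2 * Real.log (2 * M / (M - N)) + 1) := by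
  have hd : 0 < M - N := by linarith
  have hpi := Real.pi_pos
  set a : ℝ := (Real.pi * (M - N))⁻¹ with ha
  have ha0 : 0 < a := by positivity
  set K : ℝ → ℝ := fun t => a * ((1 - Real.cos (M * t)) / t ^ 2 - (1 - Real.cos (N * t)) / t ^ 2)
    with hK
  have hKi : Integrable K :=
    ((integrable_one_sub_cos_div_sq M).sub (integrable_one_sub_cos_div_sq N)).const_mul _
  refine ((MultiplierBound.cosKernel volume hKi).congr fun k _ => ?_).mono ?_
  · rw [trapezoid]
    congr 1
    have e : ∀ t : ℝ, K t * Real.cos (k * t)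
        = a / 2 * ((1 - Real.cos ((M + k) * t)) / t ^ 2)
          + a / 2 * ((1 - Real.cos ((M - k) * t)) / t ^ 2)
          - a / 2 * ((1 - Real.cos ((N + k) * t)) / t ^ 2)
          - a / 2 * ((1 - Real.cos ((N - k) * t)) / t ^ 2) := by
      intro t
      rw [hK, add_mul, sub_mul, add_mul, sub_mul, Real.cos_add, Real.cos_sub, Real.cos_add,
        Real.cos_sub]
      ring
    simp_rw [e]
    have h := fun c y : ℝ => (integrable_one_sub_cos_div_sq y).const_mul c
    have h2 : Integrable fun t : ℝ => a / 2 * ((1 - Real.cos ((M + k) * t)) / t ^ 2)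
      + a / 2 * ((1 - Real.cos ((M - k) * t)) / t ^ 2) := (h _ _).add (h _ _)
    have h3 : Integrable fun t : ℝ => a / 2 * ((1 - Real.cos ((M + k) * t)) / t ^ 2)
      + a / 2 * ((1 - Real.cos ((M - k) * t)) / t ^ 2)
      - a / 2 * ((1 - Real.cos ((N + k) * t)) / t ^ 2) := h2.sub (h _ _)
    rw [integral_sub h3 (h _ _), integral_sub h2 (h _ _), integral_add (h _ _) (h _ _)]
    simp only [integral_const_mul, integral_one_sub_cos_div_sq]
    have h5 := abs_add_add_abs_sub M k (by linarith)
    have h6 := abs_add_add_abs_sub N k hN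
    have : a / 2 * (Real.pi * |M + (k : ℝ)|) + a / 2 * (Real.pi * |M - (k : ℝ)|)
        - a / 2 * (Real.pi * |N + (k : ℝ)|) - a / 2 * (Real.pi * |N - (k : ℝ)|)
        = a * Real.pi / 2 * ((|M + (k : ℝ)| + |M - (k : ℝ)|) - (|N + (k : ℝ)| + |N - (k : ℝ)|)) := by
      ring
    rw [this, h5, h6, ha]
    field_simp
  · have e : ∀ t : ℝ, |K t| = 2 * a * (|Real.sin ((M + N) / 2 * t)| * |Real.sin ((M - N) / 2 * t)|
        / t ^ 2) := by
      intro t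
      have e1 : K t = 2 * a * (Real.sin ((M + N) / 2 * t) * Real.sin ((M - N) / 2 * t) / t ^ 2) := by
        have h7 := Real.cos_sub_cos (N * t) (M * t)
        have e3 : (N * t + M * t) / 2 = (M + N) / 2 * t := by ring
        have e4 : (N * t - M * t) / 2 = -((M - N) / 2 * t) := by ring
        rw [e3, e4, Real.sin_neg] at h7
        have : K t = a * ((Real.cos (N * t) - Real.cos (M * t)) / t ^ 2) := by
          rw [hK]; ring
        rw [this, h7]
        ring
      rw [e1, abs_mul (2 * a), abs_of_pos (by positivity : 0 < 2 * a), abs_div, abs_mul,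
        abs_of_nonneg (sq_nonneg t)]
    simp_rw [e]
    rw [integral_const_mul]
    have h8 := integral_abs_sin_mul_abs_sin_le (A := (M + N) / 2) (B := (M - N) / 2)
      (by linarith) (by linarith)
    have e5 : (M + N) / 2 / ((M - N) / 2) + 1 = 2 * M / (M - N) := by
      field_simp
      ring
    rw [e5] at h8
    calc _ ≤ 2 * a * (4 * ((M - N) / 2) / Real.pi * (Real.log (2 * M / (M - N)) + 2.467)) := by
          gcongr
      _ = 4 / Real.pi ^ 2 * Real.log (2 * M / (M - N)) + 4 / Real.pi ^ 2 * 2.467 := by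
          rw [ha]
          field_simp
      _ ≤ _ := by
          gcongr
          -- The numerical constant is just small enough: 4 · 2.467 = 9.868 < π².
          rw [div_mul_eq_mul_div, div_le_one (by positivity)]
          nlinarith [Real.pi_gt_d4]

/-! ### Integration on high frequencies. -/

/-- Integration of order `p` on high frequencies, bounded by the Favard constant. -/
theorem multiplierBound_inv_pow {N : ℕ} (hN : 0 < N) (p : ℕ) :
    MultiplierBound {k : ℤ | N ≤ k.natAbs} (fun k => ((((k.natAbs : ℝ) ^ p)⁻¹ : ℝ) : ℂ))
      (4 / Real.pi * ((N : ℝ) ^ p)⁻¹) := by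
  rcases Nat.eq_zero_or_pos p with rfl | hp
  · refine (MultiplierBound.one.congr fun k _ => by simp).mono ?_
    rw [pow_zero, inv_one, mul_one, one_le_div Real.pi_pos]
    exact Real.pi_le_four
  have hp' : (0 : ℝ) < p := by exact_mod_cast hp
  have hΓ := Real.Gamma_pos_of_pos hp'
  -- Euler's integral writes r^(−p) as a superposition of e^(−rs), that is, of Poisson multipliers
  -- with q = e^(−s). Each has norm at most (4/π) e^(−sN), so the factor 4/π does not depend on p.
  set w : ℝ → ℝ → ℝ := fun r s => (Real.Gamma p)⁻¹ * (s ^ ((p : ℝ) - 1) * Real.exp (-(r * s)))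
    with hw
  have hint : ∀ r : ℝ, 0 < r → ∫ s in Set.Ioi (0 : ℝ), w r s = (r ^ p)⁻¹ := by
    intro r hr
    rw [hw, integral_const_mul, Real.integral_rpow_mul_exp_neg_mul_Ioi hp' hr, Real.rpow_natCast,
      one_div, inv_pow]
    field_simp
  have hinteg : ∀ r : ℝ, 0 < r → IntegrableOn (w r) (Set.Ioi 0) := by
    intro r hr
    -- A non-integrable function has Bochner integral 0, while this integral has a nonzero value.
    by_contra h
    have h0 := integral_undef h
    rw [hint r hr] at h0
    exact (by positivity : (r ^ p)⁻¹ ≠ 0) h0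
  have hN' : (0 : ℝ) < N := by exact_mod_cast hN
  have key := MultiplierBound.integral (s := {k : ℤ | N ≤ k.natAbs})
    (volume.restrict (Set.Ioi (0 : ℝ))) (l := fun s k => ((w k.natAbs s : ℝ) : ℂ))
    (B := fun s => 4 / Real.pi * w N s) ?_ ?_ ((hinteg N hN').const_mul _)
  · refine (key.congr fun k hk => ?_).mono ?_
    · have hk' : N ≤ k.natAbs := hk
      rw [integral_complex_ofReal, hint]
      exact_mod_cast hN.trans_le hk'
    · rw [integral_const_mul, hint _ hN']
  · filter_upwards [ae_restrict_mem measurableSet_Ioi] with s hs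
    have hs : 0 < s := hs
    have h := (multiplierBound_pow_natAbs (Real.exp_pos (-s)).le
      (Real.exp_lt_one_iff.2 (by linarith)) N).const_mul
      (((Real.Gamma p)⁻¹ * s ^ ((p : ℝ) - 1) : ℝ) : ℂ)
    have hexp : ∀ m : ℕ, Real.exp (-s) ^ m = Real.exp (-(m * s)) := fun m => by
      rw [← Real.exp_nat_mul]; ring_nf
    refine (h.congr fun k _ => ?_).mono (le_of_eq ?_)
    · rw [← ofReal_pow, hexp, ← ofReal_mul, hw]
      congr 1
      ring
    · rw [norm_real, Real.norm_of_nonneg (by positivity), hexp, hw]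
      ring
  · intro k hk
    have hk' : N ≤ k.natAbs := hk
    exact (hinteg _ (by exact_mod_cast hN.trans_le hk')).ofReal

/-! ### The bound π² for the smoothing symbol. -/

/-- The upper bound is carried along because the induction peels off the first term and reverses the
sign of the rest. -/
theorem alternating_sum_nonneg (n : ℕ) (b : ℕ → ℝ) (hb : Antitone b) (h0 : ∀ i, 0 ≤ b i) :
    0 ≤ ∑ i ∈ Finset.range n, (-1) ^ i * b i ∧ ∑ i ∈ Finset.range n, (-1) ^ i * b i ≤ b 0 := by
  induction n generalizing b with
  | zero => simpa using h0 0
  | succ n ih =>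
    have h := ih (fun i => b (i + 1)) (fun i j hij => hb (by omega)) fun i => h0 _
    have h1 : b (0 + 1) ≤ b 0 := hb (by omega)
    rw [Finset.sum_range_succ']
    have e : ∑ i ∈ Finset.range n, (-1) ^ (i + 1) * b (i + 1)
        = -∑ i ∈ Finset.range n, (-1) ^ i * b (i + 1) := by
      rw [← Finset.sum_neg_distrib]
      exact Finset.sum_congr rfl fun i _ => by ring
    rw [e]
    constructor <;> linarith [h.1, h.2]

/-- Only odd denominators survive, doubled: 2(π²/6 − π²/24). -/
theorem sum_range_one_add_alternating_le (n : ℕ) :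
    ∑ i ∈ Finset.range n, (1 + (-1) ^ i) * (1 / ((i : ℝ) + 1) ^ 2) ≤ Real.pi ^ 2 / 4 := by
  have hodd : Summable fun m : ℕ => 1 / ((2 * m + 1 : ℕ) : ℝ) ^ 2 :=
    hasSum_zeta_two.summable.comp_injective (i := fun m : ℕ => 2 * m + 1)
      fun a b h => by simpa using h
  have heven : HasSum (fun m : ℕ => 1 / ((2 * m : ℕ) : ℝ) ^ 2) (Real.pi ^ 2 / 24) := by
    convert! hasSum_zeta_two.mul_left (1 / 4) using 1
    · ext m
      push_cast
      ring
    · ring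
  have h := (heven.even_add_odd (f := fun n : ℕ => 1 / (n : ℝ) ^ 2) hodd.hasSum).unique
    hasSum_zeta_two
  have hs : HasSum (fun i : ℕ => (1 + (-1) ^ i) * (1 / ((i : ℝ) + 1) ^ 2)) (Real.pi ^ 2 / 4) := by
    have h1 : HasSum (fun m : ℕ => (1 + (-1) ^ (2 * m)) * (1 / (((2 * m : ℕ) : ℝ) + 1) ^ 2))
        (2 * ∑' m : ℕ, 1 / ((2 * m + 1 : ℕ) : ℝ) ^ 2) := by
      convert! hodd.hasSum.mul_left 2 using 1
      ext m
      rw [pow_mul]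
      push_cast
      norm_num
    have h2 : HasSum (fun m : ℕ => (1 + (-1) ^ (2 * m + 1)) * (1 / (((2 * m + 1 : ℕ) : ℝ) + 1) ^ 2))
        (0 : ℝ) := by
      convert! hasSum_zero using 1
      ext m
      rw [pow_succ, pow_mul]
      norm_num
    convert! h1.even_add_odd (f := fun i : ℕ => (1 + (-1) ^ i) * (1 / ((i : ℝ) + 1) ^ 2)) h2
      using 1
    linarith
  refine sum_le_hasSum _ (fun i _ => ?_) hs
  rcases neg_one_pow_eq_or ℝ i with h | h <;> rw [h]
  · positivity
  · norm_num

/-- The ratio of the binomial coefficient at distance `i` from the centre to the central one. -/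
noncomputable def centralRatio (k i : ℕ) : ℝ := ((2 * k).choose (k + i) : ℝ) / (2 * k).choose k

theorem choose_central_pos (k : ℕ) : (0 : ℝ) < (2 * k).choose k := by
  exact_mod_cast Nat.choose_pos (by omega)

theorem centralRatio_nonneg (k i : ℕ) : 0 ≤ centralRatio k i := by
  unfold centralRatio; positivity

theorem antitone_centralRatio (k : ℕ) : Antitone (centralRatio k) := by
  refine antitone_nat_of_succ_le fun i => ?_
  refine div_le_div_of_nonneg_right ?_ (choose_central_pos k).le
  norm_cast
  have h := Nat.choose_succ_right_eq (2 * k) (k + i)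
  have h2 : 2 * k - (k + i) ≤ k + i + 1 := by omega
  rw [← add_assoc]
  refine Nat.le_of_mul_le_mul_right (c := k + i + 1) ?_ (by omega)
  rw [h]
  exact Nat.mul_le_mul_left _ h2

theorem centralRatio_le_one (k i : ℕ) : centralRatio k i ≤ 1 := by
  refine (antitone_centralRatio k (Nat.zero_le i)).trans (le_of_eq ?_)
  exact div_self (choose_central_pos k).ne'

/-- The symbol of the second derivative of the smoothing operator. -/
noncomputable def smoothSymbol (k : ℕ) (h : ℝ) (m : ℤ) : ℝ :=
  ∑ i ∈ Finset.range k, (-1) ^ i * (4 * (centralRatio k (i + 1) / ((i : ℝ) + 1) ^ 2)) *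
    (1 - Real.cos (m * ((i + 1) * h)))

/-- Cosines have multiplier norm at most 1. The constant term is a nonnegative alternating sum, so
it adds to the absolute coefficients without cancellation: indices with a minus sign drop out and
the others double. Bounding the central ratios by 1 leaves 8 Σ 1/m² over odd m, which is π². -/
theorem multiplierBound_smoothSymbol (k : ℕ) (h : ℝ) (s : Set ℤ) :
    MultiplierBound s (fun m => (smoothSymbol k h m : ℂ)) (Real.pi ^ 2) := by
  set b : ℕ → ℝ := fun i => centralRatio k (i + 1) / ((i : ℝ) + 1) ^ 2 with hb
  have hb0 : ∀ i, 0 ≤ b i := fun i => div_nonneg (centralRatio_nonneg _ _) (by positivity)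
  have hanti : Antitone b := by
    intro i j hij
    have hij' : (i : ℝ) ≤ j := by exact_mod_cast hij
    refine div_le_div₀ (centralRatio_nonneg _ _) (antitone_centralRatio k (by omega))
      (by positivity) ?_
    gcongr
  have hsum := MultiplierBound.sum (s := s) (Finset.range k)
    (l := fun i m => (((-1) ^ i * (4 * b i) : ℝ) : ℂ) * (Real.cos (m * ((i + 1) * h)) : ℂ))
    fun i _ => (MultiplierBound.cos ((i + 1) * h)).const_mul _
  have hone := (MultiplierBound.one (s := s)).const_mul
    ((∑ i ∈ Finset.range k, (-1) ^ i * (4 * b i) : ℝ) : ℂ)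
  refine ((hone.sub hsum).congr fun m _ => ?_).mono ?_
  · rw [smoothSymbol, mul_one]
    push_cast
    rw [← Finset.sum_sub_distrib]
    refine Finset.sum_congr rfl fun i _ => ?_
    rw [hb]
    push_cast
    ring
  · have halt := (alternating_sum_nonneg k b hanti hb0).1
    have e1 : ∑ i ∈ Finset.range k, (-1) ^ i * (4 * b i)
        = 4 * ∑ i ∈ Finset.range k, (-1) ^ i * b i := by
      rw [Finset.mul_sum]
      exact Finset.sum_congr rfl fun i _ => by ring
    have e2 : ∀ i, ‖(((-1) ^ i * (4 * b i) : ℝ) : ℂ)‖ = 4 * b i := fun i => by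
      have := hb0 i
      rw [norm_real, norm_mul, norm_pow, norm_neg, norm_one, one_pow, one_mul,
        Real.norm_of_nonneg (by positivity)]
    simp only [e2, mul_one]
    rw [e1, norm_real, Real.norm_of_nonneg (by positivity), Finset.mul_sum,
      ← Finset.sum_add_distrib]
    have hle := sum_range_one_add_alternating_le k
    calc ∑ i ∈ Finset.range k, (4 * ((-1) ^ i * b i) + 4 * b i)
        ≤ ∑ i ∈ Finset.range k, 4 * ((1 + (-1) ^ i) * (1 / ((i : ℝ) + 1) ^ 2)) := by
          refine Finset.sum_le_sum fun i _ => ?_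
          have h1 : b i ≤ 1 / ((i : ℝ) + 1) ^ 2 :=
            div_le_div_of_nonneg_right (centralRatio_le_one _ _) (by positivity)
          have h2 : 0 ≤ 1 + (-1 : ℝ) ^ i := by
            rcases neg_one_pow_eq_or ℝ i with h | h <;> rw [h] <;> norm_num
          nlinarith [mul_le_mul_of_nonneg_left h1 h2]
      _ ≤ Real.pi ^ 2 := by
          rw [← Finset.mul_sum]
          linarith

/-! ### Averaged central differences. -/

/-- The symbol of the central difference of order `2k` with step `t`. -/
noncomputable def diffSymbol (k : ℕ) (t : ℝ) (m : ℤ) : ℂ :=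
  ∑ i ∈ Finset.range (2 * k + 1), ((-1) ^ i * ((2 * k).choose i : ℝ) : ℝ) *
    cexp ((m * ((i - k) * t) : ℝ) * I)

theorem diffSymbol_eq (k : ℕ) (t : ℝ) (m : ℤ) :
    diffSymbol k t m = (((-1) ^ k * (2 * k).choose k * (1 - 2 * ∑ i ∈ Finset.range k,
      (-1) ^ i * centralRatio k (i + 1) * Real.cos (m * ((i + 1) * t))) : ℝ) : ℂ) := by
  have hC := (choose_central_pos k).ne'
  have e1 : (-1 : ℝ) ^ k * (2 * k).choose k * (1 - 2 * ∑ i ∈ Finset.range k,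
      (-1) ^ i * centralRatio k (i + 1) * Real.cos (m * ((i + 1) * t)))
      = (-1) ^ k * (2 * k).choose k + ∑ i ∈ Finset.range k,
        (-1) ^ (k + (i + 1)) * (2 * k).choose (k + (i + 1)) *
          (2 * Real.cos (m * ((i + 1) * t))) := by
    rw [mul_sub, mul_one, sub_eq_add_neg]
    congr 1
    rw [← mul_assoc, Finset.mul_sum, ← Finset.sum_neg_distrib]
    refine Finset.sum_congr rfl fun i _ => ?_
    rw [centralRatio, pow_add, pow_succ]
    field_simp
  have e2 : diffSymbol k t m = ∑ i ∈ Finset.range k,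
      (((-1) ^ (k + (i + 1)) * (2 * k).choose (k + (i + 1)) : ℝ) : ℂ) *
        cexp (-(m * ((i + 1) * t) : ℝ) * I) + (∑ i ∈ Finset.range k,
      (((-1) ^ (k + (i + 1)) * (2 * k).choose (k + (i + 1)) : ℝ) : ℂ) *
        cexp ((m * ((i + 1) * t) : ℝ) * I) + (((-1) ^ k * (2 * k).choose k : ℝ) : ℂ)) := by
    rw [diffSymbol, show 2 * k + 1 = k + (k + 1) by ring, Finset.sum_range_add,
      Finset.sum_range_succ', ← Finset.sum_range_reflect _ k]
    congr 1
    · refine Finset.sum_congr rfl fun i hi => ?_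
      have hi := Finset.mem_range.1 hi
      have hc : (2 * k).choose (k - 1 - i) = (2 * k).choose (k + (i + 1)) := by
        rw [← Nat.choose_symm (by omega : k + (i + 1) ≤ 2 * k)]
        congr 1
        omega
      have hs : (-1 : ℝ) ^ (k - 1 - i) = (-1) ^ (k + (i + 1)) := by
        rw [show k + (i + 1) = (k - 1 - i) + 2 * (i + 1) by omega, pow_add, pow_mul]
        norm_num
      have hcast : ((k - 1 - i : ℕ) : ℝ) - k = -(i + 1) := by
        rw [show k - 1 - i = k - (i + 1) by omega, Nat.cast_sub (by omega)]
        push_cast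
        ring
      rw [hc, hs, hcast]
      congr 2
      push_cast
      ring
    · congr 1
      · refine Finset.sum_congr rfl fun i _ => ?_
        congr 2
        push_cast
        ring
      · simp
  rw [e1, e2, ofReal_add, ofReal_sum, ← add_assoc, add_comm, ← Finset.sum_add_distrib]
  congr 1
  have hcos : ∀ y : ℝ, ((2 * Real.cos y : ℝ) : ℂ) = cexp (-y * I) + cexp (y * I) := fun y => by
    rw [ofReal_mul, ofReal_cos, Complex.cos]
    push_cast
    ring
  refine Finset.sum_congr rfl fun i _ => ?_
  rw [ofReal_mul (_ * _) (2 * _), hcos, mul_add]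

/-- The symbol of the averaged difference. -/
noncomputable def meanDiffSymbol (k : ℕ) (h : ℝ) (m : ℤ) : ℂ :=
  (((-1) ^ k / (2 * k).choose k : ℝ) : ℂ) *
    ∫ s in (0 : ℝ)..1, ((2 * (1 - s) : ℝ) : ℂ) * diffSymbol k (h * s) m

theorem integral_two_mul_one_sub : ∫ s in (0 : ℝ)..1, 2 * (1 - s) = 1 := by
  rw [intervalIntegral.integral_const_mul, intervalIntegral.integral_sub (by simp) (by simp)]
  norm_num

/-- The weight 2(1 − s) has mass 1, which keeps the central term 1, and turns each cosine cos(ys)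
into 2(1 − cos y)/y², which supplies the factor 1/(h² m²). -/
theorem meanDiffSymbol_eq (k : ℕ) {h : ℝ} (hh : h ≠ 0) {m : ℤ} (hm : m ≠ 0) :
    meanDiffSymbol k h m = 1 - ((smoothSymbol k h m / (h ^ 2 * (m : ℝ) ^ 2) : ℝ) : ℂ) := by
  have hC := (choose_central_pos k).ne'
  have hm' : (m : ℝ) ≠ 0 := by exact_mod_cast hm
  have hcos : ∀ i : ℕ, ∫ s in (0 : ℝ)..1, (1 - s) * Real.cos (m * ((i + 1) * h) * s)
      = (1 - Real.cos (m * ((i + 1) * h))) / (m * ((i + 1) * h)) ^ 2 := fun i =>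
    integral_one_sub_mul_cos (by positivity)
  have e : ∀ s : ℝ, 2 * (1 - s) * ((-1) ^ k * (2 * k).choose k * (1 - 2 * ∑ i ∈ Finset.range k,
      (-1) ^ i * centralRatio k (i + 1) * Real.cos (m * ((i + 1) * (h * s)))))
      = (-1) ^ k * (2 * k).choose k * (2 * (1 - s) - ∑ i ∈ Finset.range k,
        4 * ((-1) ^ i * centralRatio k (i + 1)) *
          ((1 - s) * Real.cos (m * ((i + 1) * h) * s))) := by
    intro s
    rw [mul_left_comm, mul_sub, mul_one, ← mul_assoc (2 * (1 - s)) 2, Finset.mul_sum]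
    congr 2
    refine Finset.sum_congr rfl fun i _ => ?_
    rw [show (m : ℝ) * ((i + 1) * (h * s)) = m * ((i + 1) * h) * s by ring]
    ring
  rw [meanDiffSymbol]
  simp_rw [diffSymbol_eq, ← ofReal_mul]
  rw [intervalIntegral.integral_ofReal, ← ofReal_mul, ← ofReal_one, ← ofReal_sub]
  congr 1
  simp_rw [e]
  rw [intervalIntegral.integral_const_mul, intervalIntegral.integral_sub
    (by apply Continuous.intervalIntegrable; fun_prop)
    (by apply Continuous.intervalIntegrable; fun_prop), integral_two_mul_one_sub,
    intervalIntegral.integral_finsetSum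
      (fun i _ => by apply Continuous.intervalIntegrable; fun_prop)]
  simp_rw [intervalIntegral.integral_const_mul, hcos]
  rw [← mul_assoc, div_mul_eq_mul_div, ← mul_assoc, ← pow_add, ← two_mul, pow_mul, neg_one_sq,
    one_pow, one_mul, div_self hC, one_mul]
  congr 1
  rw [smoothSymbol, Finset.sum_div]
  refine Finset.sum_congr rfl fun i _ => ?_
  field_simp

theorem norm_expPoly_meanDiffSymbol_le (k : ℕ) (h : ℝ) (S : Finset ℤ) (c : ℤ → ℂ) {D : ℝ}
    (hD : ∀ s ∈ Set.Ioc (0 : ℝ) 1, ∀ x,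
      ‖expPoly S (fun m => diffSymbol k (h * s) m * c m) x‖ ≤ D) (x : ℝ) :
    ‖expPoly S (fun m => meanDiffSymbol k h m * c m) x‖ ≤ gammaStar (2 * k) * D := by
  have e : expPoly S (fun m => meanDiffSymbol k h m * c m) x
      = (((-1) ^ k / (2 * k).choose k : ℝ) : ℂ) * ∫ s in (0 : ℝ)..1, ((2 * (1 - s) : ℝ) : ℂ) *
        expPoly S (fun m => diffSymbol k (h * s) m * c m) x := by
    simp_rw [expPoly, Finset.mul_sum]
    rw [intervalIntegral.integral_finsetSum, Finset.mul_sum]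
    · refine Finset.sum_congr rfl fun m _ => ?_
      rw [meanDiffSymbol]
      simp_rw [← mul_assoc]
      rw [intervalIntegral.integral_mul_const, intervalIntegral.integral_mul_const]
      simp only [mul_assoc]
    · intro m _
      apply Continuous.intervalIntegrable
      unfold diffSymbol
      fun_prop
  have hn : ‖(((-1) ^ k / (2 * k).choose k : ℝ) : ℂ)‖ = gammaStar (2 * k) := by
    rw [norm_real, norm_div, norm_pow, norm_neg, norm_one, one_pow, gammaStar,
      Nat.mul_div_cancel_left k two_pos, Real.norm_of_nonneg (choose_central_pos k).le]
  rw [e, norm_mul, hn]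
  have hg : 0 ≤ gammaStar (2 * k) := by unfold gammaStar; positivity
  refine mul_le_mul_of_nonneg_left ?_ hg
  calc _ ≤ ∫ s in (0 : ℝ)..1, 2 * (1 - s) * D := by
        refine intervalIntegral.norm_integral_le_of_norm_le zero_le_one
          (Filter.Eventually.of_forall fun s hs => ?_)
          (by apply Continuous.intervalIntegrable; fun_prop)
        have : 0 ≤ 2 * (1 - s) := by linarith [hs.2]
        rw [norm_mul, norm_real, Real.norm_of_nonneg this]
        exact mul_le_mul_of_nonneg_left (hD s hs x) this
    _ = D := by rw [intervalIntegral.integral_mul_const, integral_two_mul_one_sub, one_mul]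

theorem expPoly_diffSymbol (k : ℕ) (t : ℝ) (S : Finset ℤ) (c : ℤ → ℂ) (x : ℝ) :
    expPoly S (fun m => diffSymbol k t m * c m) x = ∑ i ∈ Finset.range (2 * k + 1),
      ((-1) ^ i * ((2 * k).choose i : ℝ) : ℝ) * expPoly S c (x - k * t + i * t) := by
  simp_rw [diffSymbol, Finset.sum_mul, expPoly_sum, mul_assoc, expPoly_const_mul, expPoly_shift]
  refine Finset.sum_congr rfl fun i _ => ?_
  congr 2
  ring

/-- Transfers the difference bound from f to its approximant; the absolute binomial coefficients sum
to 2^(2k), and the shift by kt turns a forward difference into a central one. -/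
theorem norm_expPoly_diffSymbol_le {f : ℝ → ℝ} {S : Finset ℤ} {c : ℤ → ℂ} {ε : ℝ}
    (hf : ∀ x, ‖(f x : ℂ) - expPoly S c x‖ ≤ ε) (k : ℕ) (t x : ℝ) :
    ‖expPoly S (fun m => diffSymbol k t m * c m) x‖
      ≤ |diff (2 * k) t f (x - k * t)| + 2 ^ (2 * k) * ε := by
  set y := x - k * t with hy
  have e : expPoly S (fun m => diffSymbol k t m * c m) x = ((diff (2 * k) t f y : ℝ) : ℂ)
      - ∑ i ∈ Finset.range (2 * k + 1), ((-1) ^ i * ((2 * k).choose i : ℝ) : ℝ) *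
        ((f (y + i * t) : ℂ) - expPoly S c (y + i * t)) := by
    rw [expPoly_diffSymbol, diff, ofReal_sum, ← Finset.sum_sub_distrib]
    refine Finset.sum_congr rfl fun i _ => ?_
    rw [ofReal_mul (_ * _) (f _), ← hy]
    ring
  rw [e]
  refine (norm_sub_le _ _).trans (add_le_add (by rw [norm_real, Real.norm_eq_abs]) ?_)
  have hs : (2 : ℝ) ^ (2 * k) = ∑ i ∈ Finset.range (2 * k + 1), ((2 * k).choose i : ℝ) := by
    exact_mod_cast (Nat.sum_range_choose (2 * k)).symm
  rw [hs, Finset.sum_mul]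
  refine norm_sum_le_of_le _ fun i _ => ?_
  rw [norm_mul, norm_real, norm_mul, norm_pow, norm_neg, norm_one, one_pow, one_mul,
    Real.norm_of_nonneg (Nat.cast_nonneg _)]
  exact mul_le_mul_of_nonneg_left (hf _) (Nat.cast_nonneg _)

/-! ### Inverting the averaged difference. -/

/-- The j-th power is split as a whole into the j-th power of the smoothing symbol and one
integration of order 2j. Iterating the bound for j = 1 would give (4/π)^j. -/
theorem multiplierBound_smoothing_pow (k : ℕ) {h N : ℝ} (hh : 0 < h) (hN : 0 < N) (j : ℕ) :
    MultiplierBound {m : ℤ | N ≤ |(m : ℝ)|}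
      (fun m => ((smoothSymbol k h m / (h ^ 2 * (m : ℝ) ^ 2) : ℝ) : ℂ) ^ j)
      (4 / Real.pi * (Real.pi ^ 2 / (h * N) ^ 2) ^ j) := by
  have hN' : 0 < ⌈N⌉₊ := Nat.ceil_pos.2 hN
  have hcast : ∀ m : ℤ, ((m.natAbs : ℕ) : ℝ) = |(m : ℝ)| := fun m => by
    rw [Nat.cast_natAbs, Int.cast_abs]
  have hsub : {m : ℤ | N ≤ |(m : ℝ)|} ⊆ {m : ℤ | ⌈N⌉₊ ≤ m.natAbs} := fun m hm => by
    have hm : N ≤ |(m : ℝ)| := hm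
    exact Nat.ceil_le.2 (by rwa [hcast])
  have h1 := ((multiplierBound_smoothSymbol k h {m : ℤ | N ≤ |(m : ℝ)|}).pow j).mul
    ((multiplierBound_inv_pow hN' (2 * j)).subset hsub)
  refine ((h1.const_mul (((h ^ (2 * j))⁻¹ : ℝ) : ℂ)).congr fun m _ => ?_).mono ?_
  · rw [← ofReal_pow, ← ofReal_mul, ← ofReal_mul, ← ofReal_pow, hcast, pow_mul |(m : ℝ)|, sq_abs,
      pow_mul]
    congr 1
    rw [div_pow, mul_pow, div_eq_mul_inv, mul_inv]
    ring
  · rw [norm_real, Real.norm_of_nonneg (by positivity)]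
    have h2 : ((⌈N⌉₊ : ℝ) ^ (2 * j))⁻¹ ≤ (N ^ (2 * j))⁻¹ := by
      gcongr
      exact Nat.le_ceil N
    calc _ ≤ (h ^ (2 * j))⁻¹ * ((Real.pi ^ 2) ^ j * (4 / Real.pi * (N ^ (2 * j))⁻¹)) := by
          gcongr
      _ = _ := by
          rw [div_pow, mul_pow, mul_pow, pow_mul, pow_mul]
          field_simp

/-- The averaged difference is boundedly invertible on high frequencies. -/
theorem norm_expPoly_le_of_meanDiff (k : ℕ) {h N : ℝ} (hh : 0 < h) (hN : 0 < N)
    (hq : Real.pi ^ 2 / (h * N) ^ 2 < 1) {S : Finset ℤ} (hS : ∀ m ∈ S, N ≤ |(m : ℝ)|)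
    {c : ℤ → ℂ} {D : ℝ} (hD : ∀ x, ‖expPoly S (fun m => meanDiffSymbol k h m * c m) x‖ ≤ D)
    (x : ℝ) : ‖expPoly S c x‖ ≤ 4 / Real.pi * (1 / (1 - Real.pi ^ 2 / (h * N) ^ 2)) * D := by
  set q := Real.pi ^ 2 / (h * N) ^ 2 with hqd
  have hq0 : 0 ≤ q := by positivity
  have hD0 : 0 ≤ D := (norm_nonneg _).trans (hD 0)
  set u : ℤ → ℂ := fun m => ((smoothSymbol k h m / (h ^ 2 * (m : ℝ) ^ 2) : ℝ) : ℂ) with hu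
  have hS' : (S : Set ℤ) ⊆ {m : ℤ | N ≤ |(m : ℝ)|} := fun m hm => hS m hm
  have hd : ∀ m ∈ S, meanDiffSymbol k h m = 1 - u m := fun m hm => by
    refine meanDiffSymbol_eq k hh.ne' ?_
    rintro rfl
    have := hS 0 hm
    rw [Int.cast_zero, abs_zero] at this
    linarith
  -- Truncated Neumann series. The remainder needs only the crude bound Σ‖c m‖, as it disappears
  -- when L tends to infinity.
  have hbound : ∀ L : ℕ, ‖expPoly S c x‖
      ≤ 4 / Real.pi * (1 / (1 - q)) * D + 4 / Real.pi * q ^ L * ∑ m ∈ S, ‖c m‖ := by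
    intro L
    have e : expPoly S c x = ∑ j ∈ Finset.range L,
        expPoly S (fun m => u m ^ j * (meanDiffSymbol k h m * c m)) x
        + expPoly S (fun m => u m ^ L * c m) x := by
      rw [← expPoly_sum, ← expPoly_add]
      refine expPoly_congr (fun m hm => ?_) x
      rw [hd m hm, ← Finset.sum_mul, ← mul_assoc, geom_sum_mul_neg]
      ring
    rw [e]
    refine (norm_add_le _ _).trans (add_le_add ?_ ?_)
    · refine (norm_sum_le_of_le _ fun j _ =>
        multiplierBound_smoothing_pow k hh hN j S hS' _ D hD x).trans ?_
      rw [← Finset.sum_mul, ← Finset.mul_sum]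
      gcongr
      rw [one_div]
      exact (summable_geometric_of_lt_one hq0 hq).sum_le_tsum _ (fun i _ => by positivity)
        |>.trans_eq (tsum_geometric_of_lt_one hq0 hq)
    · exact multiplierBound_smoothing_pow k hh hN L S hS' c _ (norm_expPoly_le S c) x
  have hlim : Filter.Tendsto (fun L : ℕ => 4 / Real.pi * (1 / (1 - q)) * D
      + 4 / Real.pi * q ^ L * ∑ m ∈ S, ‖c m‖) Filter.atTop
      (nhds (4 / Real.pi * (1 / (1 - q)) * D + 4 / Real.pi * 0 * ∑ m ∈ S, ‖c m‖)) :=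
    (((tendsto_pow_atTop_nhds_zero_of_lt_one hq0 hq).const_mul _).mul_const _).const_add _
  rw [mul_zero, zero_mul, add_zero] at hlim
  exact ge_of_tendsto' hlim hbound

/-! ### From continuous functions to trigonometric polynomials. -/

theorem exists_expPoly_near {f : ℝ → ℝ} (hf : Continuous f)
    (hper : Function.Periodic f (2 * Real.pi)) {ε : ℝ} (hε : 0 < ε) :
    ∃ (S : Finset ℤ) (c : ℤ → ℂ), ∀ x, ‖(f x : ℂ) - expPoly S c x‖ ≤ ε := by
  have : Fact (0 < 2 * Real.pi) := ⟨Real.two_pi_pos⟩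
  have hper' : Function.Periodic (fun x => (f x : ℂ)) (2 * Real.pi) := fun x => by
    simp only [hper x]
  let F : C(AddCircle (2 * Real.pi), ℂ) :=
    ⟨hper'.lift, continuous_quot_lift _ (continuous_ofReal.comp hf)⟩
  have hF : F ∈ (Submodule.span ℂ (Set.range (@fourier (2 * Real.pi)))).topologicalClosure := by
    rw [span_fourier_closure_eq_top]
    trivial
  obtain ⟨g, hg, hdist⟩ := Metric.mem_closure_iff.1 hF ε hε
  obtain ⟨c, rfl⟩ := (Finsupp.mem_span_range_iff_exists_finsupp).1 hg
  refine ⟨c.support, c, fun x => ?_⟩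
  have h := (ContinuousMap.dist_apply_le_dist (x : AddCircle (2 * Real.pi))).trans hdist.le
  rw [dist_eq_norm] at h
  have e1 : F (x : AddCircle (2 * Real.pi)) = (f x : ℂ) := rfl
  have e2 : (c.sum fun i a => a • fourier i) (x : AddCircle (2 * Real.pi))
      = expPoly c.support c x := by
    rw [Finsupp.sum, ContinuousMap.sum_apply, expPoly]
    refine Finset.sum_congr rfl fun k _ => ?_
    rw [ContinuousMap.smul_apply, fourier_coe_apply, smul_eq_mul]
    congr 2
    have : (Real.pi : ℂ) ≠ 0 := by exact_mod_cast Real.pi_ne_zero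
    push_cast
    field_simp
  rwa [e1, e2] at h

theorem re_expPoly_mem_trigPoly {S : Finset ℤ} {c : ℤ → ℂ} {M : ℕ}
    (h : ∀ k ∈ S, M < k.natAbs → c k = 0) : (fun x => (expPoly S c x).re) ∈ trigPoly M := by
  refine ⟨fun j => ∑ k ∈ S.filter (fun k => k.natAbs = j), (c k).re,
    fun j => ∑ k ∈ S.filter (fun k => k.natAbs = j), -(k.sign * (c k).im), fun x => ?_⟩
  have hterm : ∀ k : ℤ, (c k * cexp ((k * x : ℝ) * I)).re
      = (c k).re * Real.cos (k.natAbs * x) + -(k.sign * (c k).im) * Real.sin (k.natAbs * x) := by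
    intro k
    rw [Complex.mul_re, Complex.exp_ofReal_mul_I_re, Complex.exp_ofReal_mul_I_im]
    obtain ⟨n, rfl | rfl⟩ := k.eq_nat_or_neg
    · rcases Nat.eq_zero_or_pos n with rfl | hn
      · simp
      · rw [Int.sign_natCast_of_ne_zero hn.ne']
        simp
        ring
    · rcases Nat.eq_zero_or_pos n with rfl | hn
      · simp
      · rw [Int.sign_neg, Int.sign_natCast_of_ne_zero hn.ne']
        simp
  have hfil : expPoly S c x = expPoly (S.filter fun k => k.natAbs ≤ M) c x :=
    (expPoly_filter_ne_zero S _ c (fun k hk hk' => h k hk (not_le.1 hk')) x).symm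
  simp only [hfil]
  rw [expPoly, Complex.re_sum, ← Finset.sum_fiberwise_of_maps_to
    (s := S.filter fun k => k.natAbs ≤ M) (t := Finset.range (M + 1)) (g := Int.natAbs)
    fun k hk => Finset.mem_range.2 (Nat.lt_succ_of_le (Finset.mem_filter.1 hk).2)]
  refine Finset.sum_congr rfl fun j hj => ?_
  have hj : j ≤ M := Nat.lt_succ_iff.1 (Finset.mem_range.1 hj)
  have hff : (S.filter fun k => k.natAbs ≤ M).filter (fun k => k.natAbs = j)
      = S.filter fun k => k.natAbs = j := by
    ext k
    simp only [Finset.mem_filter]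
    constructor
    · rintro ⟨⟨h1, _⟩, h3⟩
      exact ⟨h1, h3⟩
    · rintro ⟨h1, h3⟩
      exact ⟨⟨h1, h3 ▸ hj⟩, h3⟩
  rw [hff, Finset.sum_mul, Finset.sum_mul, ← Finset.sum_add_distrib]
  refine Finset.sum_congr rfl fun k hk => ?_
  rw [hterm, (Finset.mem_filter.1 hk).2]

theorem supNorm_le {f : ℝ → ℝ} {B : ℝ} (h : ∀ x, |f x| ≤ B) : supNorm f ≤ B :=
  ciSup_le h

theorem supNorm_nonneg (f : ℝ → ℝ) : 0 ≤ supNorm f :=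
  Real.iSup_nonneg fun _ => abs_nonneg _

theorem bestApprox_le {m : ℕ} {f τ : ℝ → ℝ} (hτ : τ ∈ trigPoly m) {B : ℝ}
    (h : ∀ x, |f x - τ x| ≤ B) : bestApprox m f ≤ B := by
  refine (csInf_le ⟨0, ?_⟩ (Set.mem_image_of_mem _ hτ)).trans (supNorm_le h)
  rintro _ ⟨σ, _, rfl⟩
  exact supNorm_nonneg _

/-! ### The even-order inequality. -/

/-- The constant in the inequality of Jackson and Stechkin. -/
noncomputable def jacksonConst (α : ℝ) : ℝ :=
  4 / Real.pi * (α / (α - 1)) *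
    (4 / Real.pi ^ 2 * Real.log (2 * Real.sqrt α / (Real.sqrt α - 1)) + 2)

theorem one_lt_sqrt {α : ℝ} (hα : 1 < α) : 1 < Real.sqrt α := by
  rw [Real.lt_sqrt zero_le_one]
  linarith

theorem log_arg_nonneg {α : ℝ} (hα : 1 < α) :
    0 ≤ Real.log (2 * Real.sqrt α / (Real.sqrt α - 1)) := by
  have := one_lt_sqrt hα
  refine Real.log_nonneg ?_
  rw [one_le_div (by linarith)]
  linarith

theorem bestApprox_le_of_near {α : ℝ} (hα : 1 < α) (k : ℕ) {n : ℕ} (hn : 1 ≤ n) {f : ℝ → ℝ}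
    {S : Finset ℤ} {c : ℤ → ℂ} {ε : ℝ} (hf : ∀ x, ‖(f x : ℂ) - expPoly S c x‖ ≤ ε) {W : ℝ}
    (hW : ∀ t ∈ Set.Ioc 0 (α * Real.pi / n), ∀ x, |diff (2 * k) t f x| ≤ W) :
    bestApprox (n - 1) f
      ≤ ε + jacksonConst α * gammaStar (2 * k) * (W + 2 ^ (2 * k) * ε) := by
  have hn' : (0 : ℝ) < n := by exact_mod_cast hn
  have hs := one_lt_sqrt hα
  have hs0 : 0 < Real.sqrt α := by linarith
  have hsq : Real.sqrt α ^ 2 = α := Real.sq_sqrt (by linarith)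
  have hpi := Real.pi_pos
  set h : ℝ := α * Real.pi / n with hh
  -- The geometric mean of n/α and n: then (hN)² = απ², so the Neumann ratio is 1/α, while N stays a
  -- fixed proportion below n.
  set N : ℝ := n / Real.sqrt α with hNd
  have hh0 : 0 < h := by
    have : 0 < α := by linarith
    positivity
  have hN0 : 0 < N := by positivity
  have hNn : N < n := div_lt_self hn' hs
  have hq : Real.pi ^ 2 / (h * N) ^ 2 = 1 / α := by
    have : (h * N) ^ 2 = α * Real.pi ^ 2 := by
      rw [hh, hNd]
      field_simp
      rw [hsq]
    rw [this]
    have : α ≠ 0 := by linarith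
    field_simp
  have hlog : 2 * (n : ℝ) / (n - N) = 2 * Real.sqrt α / (Real.sqrt α - 1) := by
    have h1 : Real.sqrt α - 1 ≠ 0 := by linarith
    have h2 : (n : ℝ) - N ≠ 0 := by linarith
    rw [div_eq_div_iff h2 h1, hNd]
    field_simp
  set v : ℤ → ℂ := trapezoid N n with hv
  have hV := (MultiplierBound.one (s := Set.univ)).sub
    (multiplierBound_trapezoid hN0.le hNn Set.univ)
  rw [hlog] at hV
  set B : ℝ := 4 / Real.pi ^ 2 * Real.log (2 * Real.sqrt α / (Real.sqrt α - 1)) + 2 with hB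
  have hV := hV.mono (B' := B) (by rw [hB]; linarith)
  have hmean := norm_expPoly_meanDiffSymbol_le k h S c (D := W + 2 ^ (2 * k) * ε)
    fun s hs x => (norm_expPoly_diffSymbol_le hf k (h * s) x).trans (by
      gcongr
      exact hW _ ⟨mul_pos hh0 hs.1, mul_le_of_le_one_right hh0.le hs.2⟩ _)
  -- Multipliers commute, so this also bounds the averaged difference of the high-frequency part (1
  -- − V) of the sum.
  have hG := hV S (Set.subset_univ _) _ _ hmean
  set S' := S.filter fun m : ℤ => N ≤ |(m : ℝ)| with hS'
  have hvone : ∀ m ∈ S, ¬ N ≤ |(m : ℝ)| → (1 - v m) = 0 := fun m _ hm => by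
    have hm : |(m : ℝ)| < N := not_le.1 hm
    rw [hv, trapezoid, max_eq_left (hm.le.trans hNn.le), max_eq_left hm.le,
      div_self (by linarith), ofReal_one, sub_self]
  have hg : ∀ x, ‖expPoly S (fun m => (1 - v m) * c m) x‖
      ≤ 4 / Real.pi * (1 / (1 - 1 / α)) * (B * (gammaStar (2 * k) * (W + 2 ^ (2 * k) * ε))) := by
    intro x
    rw [← expPoly_filter_ne_zero S (fun m : ℤ => N ≤ |(m : ℝ)|) _
      (fun m hm hm' => by rw [hvone m hm hm', zero_mul]), ← hq]
    refine norm_expPoly_le_of_meanDiff k hh0 hN0 ?_ (fun m hm => (Finset.mem_filter.1 hm).2) ?_ x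
    · rw [hq, div_lt_one (by linarith)]
      exact hα
    · intro y
      rw [expPoly_filter_ne_zero S (fun m : ℤ => N ≤ |(m : ℝ)|) _
        (fun m hm hm' => by rw [hvone m hm hm', zero_mul, mul_zero])]
      refine le_trans (le_of_eq ?_) (hG y)
      exact congrArg norm (expPoly_congr (fun m _ => by ring) y)
  have hα' : 1 / (1 - 1 / α) = α / (α - 1) := by
    have h1 : α ≠ 0 := by linarith
    field_simp
  rw [hα'] at hg
  refine bestApprox_le (re_expPoly_mem_trigPoly (S := S) (c := fun m => v m * c m) ?_) fun x => ?_
  · intro m _ hm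
    have hm' : (n : ℝ) ≤ |(m : ℝ)| := by
      rw [← Int.cast_abs, ← Nat.cast_natAbs]
      exact_mod_cast (by omega : n ≤ m.natAbs)
    simp only [hv, trapezoid]
    rw [max_eq_right hm', max_eq_right (hNn.le.trans hm'), sub_self, zero_div, ofReal_zero,
      zero_mul]
  · have e : f x - (expPoly S (fun m => v m * c m) x).re
        = (((f x : ℂ) - expPoly S c x) + expPoly S (fun m => (1 - v m) * c m) x).re := by
      have : expPoly S (fun m => (1 - v m) * c m) x
          = expPoly S c x - expPoly S (fun m => v m * c m) x := by
        rw [← expPoly_sub]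
        exact expPoly_congr (fun m _ => by ring) x
      rw [this]
      simp
    rw [e]
    refine (Complex.abs_re_le_norm _).trans ((norm_add_le _ _).trans (add_le_add (hf x) ?_))
    refine (hg x).trans_eq ?_
    rw [jacksonConst, hB]
    ring

theorem bestApprox_le_of_diff_le {α : ℝ} (hα : 1 < α) (k : ℕ) {n : ℕ} (hn : 1 ≤ n) {f : ℝ → ℝ}
    (hf : Continuous f) (hper : Function.Periodic f (2 * Real.pi)) {W : ℝ}
    (hW : ∀ t ∈ Set.Ioc 0 (α * Real.pi / n), ∀ x, |diff (2 * k) t f x| ≤ W) :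
    bestApprox (n - 1) f ≤ jacksonConst α * gammaStar (2 * k) * W := by
  have hlim : Filter.Tendsto
      (fun ε : ℝ => ε + jacksonConst α * gammaStar (2 * k) * (W + 2 ^ (2 * k) * ε))
      (nhdsWithin 0 (Set.Ioi 0))
      (nhds (0 + jacksonConst α * gammaStar (2 * k) * (W + 2 ^ (2 * k) * 0))) :=
    (Continuous.tendsto (by fun_prop) 0).mono_left nhdsWithin_le_nhds
  rw [mul_zero, add_zero, zero_add] at hlim
  refine ge_of_tendsto hlim ?_
  filter_upwards [self_mem_nhdsWithin] with ε hε
  obtain ⟨S, c, hc⟩ := exists_expPoly_near hf hper hε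
  exact bestApprox_le_of_near hα k hn hc hW

/-! ### The modulus of smoothness and odd orders. -/

theorem abs_diff_le_two_pow_mul {f : ℝ → ℝ} {B : ℝ} (hB : ∀ x, |f x| ≤ B) (r : ℕ) (t x : ℝ) :
    |diff r t f x| ≤ 2 ^ r * B := by
  have hs : (2 : ℝ) ^ r = ∑ i ∈ Finset.range (r + 1), (r.choose i : ℝ) := by
    exact_mod_cast (Nat.sum_range_choose r).symm
  rw [diff, hs, Finset.sum_mul]
  refine (Finset.abs_sum_le_sum_abs _ _).trans (Finset.sum_le_sum fun i _ => ?_)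
  rw [abs_mul, abs_mul, abs_pow, abs_neg, abs_one, one_pow, one_mul, Nat.abs_cast]
  exact mul_le_mul_of_nonneg_left (hB _) (Nat.cast_nonneg _)

theorem abs_diff_le_modulus {f : ℝ → ℝ} (hf : Continuous f)
    (hper : Function.Periodic f (2 * Real.pi)) (r : ℕ) {δ t : ℝ} (ht : t ∈ Set.Ioc 0 δ) (x : ℝ) :
    |diff r t f x| ≤ modulus r f δ := by
  obtain ⟨B, hB⟩ : ∃ B, ∀ x, |f x| ≤ B := by
    have hb := hper.isBounded_of_continuous Real.two_pi_pos.ne' hf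
    obtain ⟨B, hB⟩ := hb.exists_norm_le
    exact ⟨B, fun x => hB _ ⟨x, rfl⟩⟩
  have h1 : |diff r t f x| ≤ supNorm (diff r t f) :=
    le_ciSup (f := fun x => |diff r t f x|)
      ⟨2 ^ r * B, by rintro _ ⟨y, rfl⟩; exact abs_diff_le_two_pow_mul hB r t y⟩ x
  refine h1.trans (le_csSup ⟨2 ^ r * B, ?_⟩ (Set.mem_image_of_mem _ ht))
  rintro _ ⟨s, _, rfl⟩
  exact supNorm_le fun y => abs_diff_le_two_pow_mul hB r s y

theorem diff_succ (r : ℕ) (t : ℝ) (f : ℝ → ℝ) (x : ℝ) :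
    diff (r + 1) t f x = diff r t f x - diff r t f (x + t) := by
  have h1 : diff r t f x = f x + ∑ i ∈ Finset.range (r + 1),
      (-1 : ℝ) ^ (i + 1) * (r.choose (i + 1) : ℝ) * f (x + (i + 1 : ℕ) * t) := by
    rw [diff, Finset.sum_range_succ', Finset.sum_range_succ _ r, Nat.choose_succ_self]
    simp
    ring
  rw [h1, diff, diff, Finset.sum_range_succ', add_sub_assoc, ← Finset.sum_sub_distrib, add_comm]
  congr 1
  · simp
  · refine Finset.sum_congr rfl fun i _ => ?_
    rw [Nat.choose_succ_succ, show x + t + i * t = x + (i + 1 : ℕ) * t by push_cast; ring]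
    push_cast
    ring

/-- This factor 2 exactly absorbs the loss in bounding a difference of order 2k + 2 by two of order
2k + 1, so odd orders keep the same constant. -/
theorem gammaStar_two_mul_succ (k : ℕ) : gammaStar (2 * k + 1) = 2 * gammaStar (2 * (k + 1)) := by
  have e1 : (2 * k + 1) / 2 = k := by omega
  have e2 : 2 * (k + 1) / 2 = k + 1 := by omega
  have h : (2 * (k + 1)).choose (k + 1) = 2 * (2 * k + 1).choose k := by
    have h1 : (2 * k + 1).choose (k + 1) = (2 * k + 1).choose k := by
      rw [← Nat.choose_symm (by omega : k ≤ 2 * k + 1)]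
      congr 1
      omega
    rw [show 2 * (k + 1) = (2 * k + 1) + 1 by ring, Nat.choose_succ_succ, h1]
    ring
  have h0 : ((2 * k + 1).choose k : ℝ) ≠ 0 := by
    exact_mod_cast (Nat.choose_pos (by omega : k ≤ 2 * k + 1)).ne'
  rw [gammaStar, gammaStar, e1, e2, h]
  push_cast
  field_simp

end JacksonStechkin

theorem theorem2 (α : ℝ) (hα : 1 < α) :
    ∃ c : ℝ,
      c ≤ 4 / Real.pi * (α / (α - 1)) *
        (4 / Real.pi ^ 2 * Real.log (2 * Real.sqrt α / (Real.sqrt α - 1)) + 2) ∧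
      ∀ r n : ℕ, 1 ≤ r → 1 ≤ n →
        ∀ f : ℝ → ℝ, Continuous f → Function.Periodic f (2 * Real.pi) →
          JacksonStechkin.bestApprox (n - 1) f ≤
            c * JacksonStechkin.gammaStar r *
              JacksonStechkin.modulus r f (α * Real.pi / n) := by
  refine ⟨JacksonStechkin.jacksonConst α, le_rfl, fun r n _ hn f hf hper => ?_⟩
  obtain ⟨k, rfl | rfl⟩ := r.even_or_odd'
  · exact JacksonStechkin.bestApprox_le_of_diff_le hα k hn hf hper fun t ht x =>
      JacksonStechkin.abs_diff_le_modulus hf hper _ ht x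
  · refine (JacksonStechkin.bestApprox_le_of_diff_le hα (k + 1) hn hf hper
      (W := 2 * JacksonStechkin.modulus (2 * k + 1) f (α * Real.pi / n)) fun t ht x => ?_).trans_eq ?_
    · rw [show 2 * (k + 1) = (2 * k + 1) + 1 by ring, JacksonStechkin.diff_succ]
      refine (abs_sub _ _).trans ?_
      have h1 := JacksonStechkin.abs_diff_le_modulus hf hper (2 * k + 1) ht x
      have h2 := JacksonStechkin.abs_diff_le_modulus hf hper (2 * k + 1) ht (x + t)
      linarith
    · rw [JacksonStechkin.gammaStar_two_mul_succ]
      ring
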